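/- For $k\neq 0$ let $\mathbb{O}_k^n$ be the sphere $\{x\in\mathbb{R}^{n+1} : \langle x,x\rangle = 1/k\}$ if $k>0$, and the hyperbolic space $\{x\in\mathbb{L}^{n+1} : \langle x,x\rangle = 1/k,\ x_0>0\}$ if $k<0$, where $\mathbb{L}^{n+1}$ is $\mathbb{R}^{n+1}$ with the scalar product $-x_0y_0+\sum_{i\ge 1}x_iy_i$. Let $k_1,\dots,k_\ell$ be nonzero reals, $\hat{\mathbb{O}}=\mathbb{O}_{k_1}^{n_1}\times\cdots\times\mathbb{O}_{k_\ell}^{n_\ell}$, and let $\pi_i(x_1,\dots,x_\ell)=(0,\dots,x_i,\dots,0)$. Let $M^m$ be a connected Riemannian manifold of dimension $m\ge 1$ and $f:M^m\to\hat{\mathbb{O}}$ an isometric immersion with second fundamental form $\alpha$. Let $\mathbf{R}_i=\mathbf{L}_i^{\dagger}\mathbf{L}_i : TM\to TM$, where $\mathbf{L}_i=\pi_i\circ f_*$ and $\dagger$ denotes the adjoint, and let $\mathcal{N}_1(x)=\operatorname{span}\{\alpha(X,Y) : X,Y\in T_xM\}$ be the first normal space of $f$ at $x$. Assume that $\mathcal{N}_1$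 is a vector subbundle of rank $\bar n$ of the normal bundle $T^\perp M$ that is parallel in the normal connection, and that $k_i\mathbf{R}_i=k_j\mathbf{R}_j$ for all $i,j\in\{1,\dots,\ell\}$. Then $k_ik_j>0$ for all $i,j$, and $m+\bar n\le\min\{n_1,\dots,n_\ell\}$. Moreover, put $M_i=\prod_{j\ne i}k_j$, $\lambda=\sum_i M_i$ and $a_i=\sqrt{M_i/\lambda}$. Then $a_i^2k_i$ has the same value $k$ for all $i$, and $$f=(j_1\times\cdots\times j_\ell)\circ g\circ\bar f ,$$ where - each $j_i:\mathbb{O}_{k_i}^{m+\bar n}\hookrightarrow\mathbb{O}_{k_i}^{n_i}$ is a totally geodesic inclusion (the restriction of a linear map of the ambient spaces that preserves the scalar products); - $g:\mathbb{O}_k^{m+\bar n}\to\prod_{i=1}^{\ell}\mathbb{O}_{k_i}^{m+\bar n}$ is a totally geodesic isometric immersion of the form $g(x)=(a_1T_1(x),\dots,a_\ell T_\ell(x))$, where each $T_i$ is a linear isometry of the ambient space of $\mathbb{O}_k^{m+\bar n}$ with $T_i(\mathbb{O}_k^{m+\bar n})=\mathbb{O}_k^{m+\bar n}$; - $\bar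 f:M^m\to\mathbb{O}_k^{m+\bar n}$ is an isometric immersion. -/

import Mathlib

open scoped Manifold ContDiff Topology

noncomputable section

/-! ### Submanifold geometry inside a real vector space carrying a scalar product

`V` is a finite-dimensional real vector space with a (possibly indefinite) scalar product `B`;
a submanifold of `V` is given by its set of points `S`. -/

section Ambient

variable {V : Type*} [NormedAddCommGroup V] [NormedSpace ℝ V]

/-- The tangent space of `S` at `p`: velocities at time `0` of smooth curves of `S` through `p`. -/
def tangentSpaceAt (S : Set V) (p : V) : Submodule ℝ V :=
  Submodule.span ℝ {v | ∃ γ : ℝ → V, ContDiffAt ℝ ∞ γ 0 ∧ (∀ᶠ t in 𝓝 0, γ t ∈ S) ∧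
    γ 0 = p ∧ deriv γ 0 = v}

open Classical in
/-- The `B`-orthogonal projection of `V` onto `W`. It exists exactly when
`V = W ⊕ Wᗮ`, i.e. when `B` is nondegenerate on `W`; otherwise the value is `0`. -/
def orthProj (B : LinearMap.BilinForm ℝ V) (W : Submodule ℝ V) : V →ₗ[ℝ] V :=
  if h : IsCompl W (B.orthogonal W) then W.projection (B.orthogonal W) h else 0

variable {V' : Type*} [NormedAddCommGroup V'] [NormedSpace ℝ V']

/-- `h : S → S'` is a totally geodesic (isometric) immersion between the submanifolds `S ⊆ V`
and `S' ⊆ V'`: it is the restriction of a smooth map `H` of the ambient spaces, its differential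
preserves the scalar products of tangent vectors, and its second fundamental form `α` vanishes.
For a smooth curve `γ` of `S` with velocity `X` at time `0`, `α (X, X)` is the component of the
acceleration of `h ∘ γ` in the normal space of `h`, that is, in the set of vectors tangent to `S'`
and orthogonal to the image of the differential of `h`; and `α`, being symmetric, vanishes
as soon as all the `α (X, X)` do. -/
def IsTotallyGeodesicImmersion (B : LinearMap.BilinForm ℝ V) {S : Set V}
    (B' : LinearMap.BilinForm ℝ V') {S' : Set V'} (h : S → S') : Prop :=
  ∃ H : V → V', ContDiff ℝ ∞ H ∧ (∀ p : S, H p = h p) ∧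
    (∀ p : S, ∀ X ∈ tangentSpaceAt S (p : V), ∀ Y ∈ tangentSpaceAt S (p : V),
      B' (fderiv ℝ H p X) (fderiv ℝ H p Y) = B X Y) ∧
    (∀ γ : ℝ → V, ContDiffAt ℝ ∞ γ 0 → (∀ᶠ t in 𝓝 0, γ t ∈ S) →
      orthProj B' (tangentSpaceAt S' (H (γ 0)) ⊓
          B'.orthogonal ((tangentSpaceAt S (γ 0)).map (fderiv ℝ H (γ 0)).toLinearMap))
        (deriv (deriv (fun t => H (γ t))) 0) = 0)

end Ambient

/-! ### Isometric immersions of Riemannian manifolds into such submanifolds -/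

section Immersion

variable {m : ℕ} {M : Type*} [TopologicalSpace M] [ChartedSpace (EuclideanSpace ℝ (Fin m)) M]
  [IsManifold (𝓡 m) ∞ M]

/-- The smooth Riemannian metrics on the `m`-dimensional smooth manifold `M`. -/
abbrev SmoothMetric (m : ℕ) (M : Type*) [TopologicalSpace M]
    [ChartedSpace (EuclideanSpace ℝ (Fin m)) M] [IsManifold (𝓡 m) ∞ M] :=
  Bundle.ContMDiffRiemannianMetric (𝓡 m) ∞ (EuclideanSpace ℝ (Fin m))
    (fun x : M => TangentSpace (𝓡 m) x)

/-- The scalar product on the tangent space `T_x M`. -/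
def SmoothMetric.form (g : SmoothMetric m M) (x : M) :
    LinearMap.BilinForm ℝ (TangentSpace (𝓡 m) x) :=
  LinearMap.mk₂ ℝ (fun X Y => g.inner x X Y) (by simp) (by simp) (by simp) (by simp)

lemma SmoothMetric.form_nondegenerate (g : SmoothMetric m M) (x : M) :
    (SmoothMetric.form g x).Nondegenerate := by
  constructor
  · intro X hX
    by_contra hne
    exact (g.pos x X hne).ne' (hX X)
  · intro X hX
    by_contra hne
    exact (g.pos x X hne).ne' (hX X)

instance tangentSpace_finiteDimensional (x : M) :
    FiniteDimensional ℝ (TangentSpace (𝓡 m) x) :=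
  inferInstanceAs (FiniteDimensional ℝ (EuclideanSpace ℝ (Fin m)))

variable (m) {V : Type*} [NormedAddCommGroup V] [NormedSpace ℝ V]

/-- The differential at `x` of a map into `V`. -/
def differentialAt (F : M → V) (x : M) : TangentSpace (𝓡 m) x →ₗ[ℝ] V :=
  (mfderiv (𝓡 m) 𝓘(ℝ, V) F x : TangentSpace (𝓡 m) x →L[ℝ] V).toLinearMap

/-- The adjoint `L† : V → T_x M` of a linear map `L : T_x M → V`: `⟨L† Z, Y⟩ = ⟨Z, L Y⟩`. -/
def adjointAt (g : SmoothMetric m M) (B : LinearMap.BilinForm ℝ V) (x : M)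
    (L : TangentSpace (𝓡 m) x →ₗ[ℝ] V) : V →ₗ[ℝ] TangentSpace (𝓡 m) x :=
  ((SmoothMetric.form g x).toDual (SmoothMetric.form_nondegenerate g x)).symm.toLinearMap ∘ₗ
    B.compl₂ L

/-- `f : M → S` is an isometric immersion (a smooth map whose differential preserves the
scalar products; it is injective because the metric of `M` is positive definite). -/
structure IsIsometricImmersion (g : SmoothMetric m M) (B : LinearMap.BilinForm ℝ V) {S : Set V}
    (f : M → S) : Prop where
  contMDiff : ContMDiff (𝓡 m) 𝓘(ℝ, V) ∞ (fun x => (f x : V))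
  isometric : ∀ (x : M) (X Y : TangentSpace (𝓡 m) x),
    B (differentialAt m (fun y => (f y : V)) x X) (differentialAt m (fun y => (f y : V)) x Y) =
      g.inner x X Y

/-- The normal space `T_x^⊥ M` of `f : M → S`: vectors tangent to `S` at `f x` and orthogonal
to `f_* T_x M`. -/
def normalSpaceAt (B : LinearMap.BilinForm ℝ V) {S : Set V} (f : M → S) (x : M) :
    Submodule ℝ V :=
  tangentSpaceAt S (f x : V) ⊓
    B.orthogonal (LinearMap.range (differentialAt m (fun y => (f y : V)) x))

/-- The second derivative at `x`, in the preferred chart at `x`, of a map `F : M → V`; it is the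
derivative in the direction `X` of `F_* Y`, for the vector field `Y` with constant coordinates.
(Tangent vectors at `x` are given by their coordinates in that chart.) -/
def secondDerivAt (F : M → V) (x : M) (X Y : TangentSpace (𝓡 m) x) : V :=
  fderiv ℝ (fderiv ℝ (F ∘ (extChartAt (𝓡 m) x).symm)) (extChartAt (𝓡 m) x x)
    (show EuclideanSpace ℝ (Fin m) from X) (show EuclideanSpace ℝ (Fin m) from Y)

/-- The second fundamental form `α (X, Y)` of `f : M → S`: the normal component of the derivative
of `f_* Y` in the direction `X`. It does not depend on the chart, because a change of chart
changes the second derivative by a vector of `f_* T_x M`. -/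
def secondFundamentalForm (B : LinearMap.BilinForm ℝ V) {S : Set V} (f : M → S) (x : M)
    (X Y : TangentSpace (𝓡 m) x) : V :=
  orthProj B (normalSpaceAt m B f x) (secondDerivAt m (fun y => (f y : V)) x X Y)

/-- The first normal space of `f` at `x`. -/
def firstNormalSpace (B : LinearMap.BilinForm ℝ V) {S : Set V} (f : M → S) (x : M) :
    Submodule ℝ V :=
  Submodule.span ℝ {ξ | ∃ X Y : TangentSpace (𝓡 m) x, ξ = secondFundamentalForm m B f x X Y}

/-- The normal connection `∇^⊥_X ξ`: the normal component of the derivative of `ξ` along `X`. -/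
def normalConnection (B : LinearMap.BilinForm ℝ V) {S : Set V} (f : M → S) (ξ : M → V) (x : M)
    (X : TangentSpace (𝓡 m) x) : V :=
  orthProj B (normalSpaceAt m B f x) (differentialAt m ξ x X)

/-- The family `N` of subspaces is a smooth vector subbundle of rank `r` of the normal bundle
of `f`, and it is parallel: `∇^⊥_X ξ` is a section of `N` for each (local) section `ξ` of `N`. -/
structure IsParallelNormalSubbundle (B : LinearMap.BilinForm ℝ V) {S : Set V} (f : M → S)
    (N : M → Submodule ℝ V) (r : ℕ) : Prop where
  le_normal : ∀ x, N x ≤ normalSpaceAt m B f x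
  finrank_eq : ∀ x, Module.finrank ℝ (N x) = r
  exists_frame : ∀ x, ∃ U : Set M, IsOpen U ∧ x ∈ U ∧ ∃ s : Fin r → M → V,
    (∀ a, ContMDiffOn (𝓡 m) 𝓘(ℝ, V) ∞ (s a) U) ∧
    ∀ y ∈ U, N y = Submodule.span ℝ (Set.range fun a => s a y)
  parallel : ∀ (U : Set M) (ξ : M → V), IsOpen U → ContMDiffOn (𝓡 m) 𝓘(ℝ, V) ∞ ξ U →
    (∀ y ∈ U, ξ y ∈ N y) → ∀ x ∈ U, ∀ X : TangentSpace (𝓡 m) x,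
      normalConnection m B f ξ x X ∈ N x

end Immersion

/-! ### Space forms of nonzero curvature and their products -/

/-- The scalar product of `ℝ^{n+1}` (if `0 ≤ k`), resp. of the Lorentz space `𝕃^{n+1}`
(if `k < 0`). -/
def ambientForm (k : ℝ) (n : ℕ) : LinearMap.BilinForm ℝ (Fin (n + 1) → ℝ) :=
  LinearMap.mk₂ ℝ
    (fun x y => (if k < 0 then -1 else 1) * (x 0 * y 0) + ∑ i : Fin n, x i.succ * y i.succ)
    (by intro x x' y; simp only [Pi.add_apply, add_mul, Finset.sum_add_distrib]; ring)
    (by intro c x y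
        simp only [Pi.smul_apply, smul_eq_mul, mul_add, Finset.mul_sum, mul_assoc]
        ring_nf)
    (by intro x y y'; simp only [Pi.add_apply, mul_add, Finset.sum_add_distrib]; ring)
    (by intro c x y
        simp only [Pi.smul_apply, smul_eq_mul, mul_add, Finset.mul_sum, mul_left_comm _ c])

/-- The model of the `n`-dimensional space form of curvature `k ≠ 0`: the sphere of radius
`1 / √k` if `k > 0`, and the hyperbolic space (upper sheet of a hyperboloid) if `k < 0`. -/
def spaceForm (k : ℝ) (n : ℕ) : Set (Fin (n + 1) → ℝ) :=
  {x | ambientForm k n x x = 1 / k ∧ (k < 0 → 0 < x 0)}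

section Products

variable {ℓ : ℕ}

/-- The scalar product of the product of the ambient spaces of the factors. -/
def prodForm (k : Fin ℓ → ℝ) (n : Fin ℓ → ℕ) :
    LinearMap.BilinForm ℝ (∀ i, Fin (n i + 1) → ℝ) :=
  ∑ i, (ambientForm (k i) (n i)).compl₁₂ (LinearMap.proj i) (LinearMap.proj i)

/-- The product of the space forms of curvatures `k i` and dimensions `n i`. -/
def prodSpaceForm (k : Fin ℓ → ℝ) (n : Fin ℓ → ℕ) : Set (∀ i, Fin (n i + 1) → ℝ) :=
  {x | ∀ i, x i ∈ spaceForm (k i) (n i)}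

/-- The projection `π_i (x_1, …, x_ℓ) = (0, …, x_i, …, 0)`. -/
def factorProj (n : Fin ℓ → ℕ) (i : Fin ℓ) :
    (∀ i, Fin (n i + 1) → ℝ) →ₗ[ℝ] (∀ i, Fin (n i + 1) → ℝ) :=
  LinearMap.single ℝ (fun i => Fin (n i + 1) → ℝ) i ∘ₗ LinearMap.proj i

/-- The product map `j_1 × ⋯ × j_ℓ`. -/
def prodSpaceFormMap {k : Fin ℓ → ℝ} {n n' : Fin ℓ → ℕ}
    (j : ∀ i, spaceForm (k i) (n i) → spaceForm (k i) (n' i)) (x : prodSpaceForm k n) :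
    prodSpaceForm k n' :=
  ⟨fun i => j i ⟨x.1 i, x.2 i⟩, fun i => (j i ⟨x.1 i, x.2 i⟩).2⟩

/-- The tensor `R_i = L_i† L_i` on `T_x M`, where `L_i = π_i ∘ f_*`. -/
def tensorR {m : ℕ} {M : Type*} [TopologicalSpace M] [ChartedSpace (EuclideanSpace ℝ (Fin m)) M]
    [IsManifold (𝓡 m) ∞ M] (g : SmoothMetric m M) {k : Fin ℓ → ℝ} {n : Fin ℓ → ℕ}
    (f : M → prodSpaceForm k n) (i : Fin ℓ) (x : M) :
    TangentSpace (𝓡 m) x →ₗ[ℝ] TangentSpace (𝓡 m) x :=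
  adjointAt m g (prodForm k n) x
      (factorProj n i ∘ₗ differentialAt m (fun y => (f y : ∀ i, Fin (n i + 1) → ℝ)) x) ∘ₗ
    (factorProj n i ∘ₗ differentialAt m (fun y => (f y : ∀ i, Fin (n i + 1) → ℝ)) x)

/-- `M_i = ∏_{j ≠ i} k_j`. -/
def coProd (k : Fin ℓ → ℝ) (i : Fin ℓ) : ℝ := ∏ j ∈ Finset.univ.erase i, k j

/-- The weight `a_i = √(M_i / λ)`, where `λ = ∑ j, M_j`. -/
def weight (k : Fin ℓ → ℝ) (i : Fin ℓ) : ℝ := Real.sqrt (coProd k i / ∑ j, coProd k j)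

/-- A totally geodesic inclusion of the `d`-dimensional space form of curvature `k` into the
`n`-dimensional one: a totally geodesic immersion that is the restriction of a linear map of
the ambient spaces preserving the scalar products (so it maps onto the intersection of the
larger space form with a linear subspace). -/
def IsTotallyGeodesicInclusion {k : ℝ} {d n : ℕ} (j : spaceForm k d → spaceForm k n) : Prop :=
  IsTotallyGeodesicImmersion (ambientForm k d) (ambientForm k n) j ∧
    ∃ J : (Fin (d + 1) → ℝ) →ₗ[ℝ] (Fin (n + 1) → ℝ),
      (∀ x y, ambientForm k n (J x) (J y) = ambientForm k d x y) ∧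
      ∀ p : spaceForm k d, (j p : Fin (n + 1) → ℝ) = J p

/-- `g` is the weighted sum `x ↦ (a_1 T_1 x, …, a_ℓ T_ℓ x)` with the weights `a_i` above, where
each `T_i` is a linear isometry of the ambient space of the space form of curvature `κ` that maps
this space form onto itself. -/
def IsStandardWeightedSum {k : Fin ℓ → ℝ} {κ : ℝ} {d : ℕ}
    (g : spaceForm κ d → prodSpaceForm k (fun _ => d)) : Prop :=
  ∃ T : Fin ℓ → ((Fin (d + 1) → ℝ) ≃ₗ[ℝ] (Fin (d + 1) → ℝ)),
    (∀ i x y, ambientForm κ d (T i x) (T i y) = ambientForm κ d x y) ∧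
    (∀ i, T i '' spaceForm κ d = spaceForm κ d) ∧
    ∀ (x : spaceForm κ d) (i : Fin ℓ),
      (g x : Fin ℓ → Fin (d + 1) → ℝ) i = weight k i • T i x

end Products

end

/-! ### Scalar products of the ambient spaces -/

section AmbientForm

/-! Since `f` is isometric, the tensors `R_i` sum to the identity; as the `k_i R_i` coincide, `R_i =
s_i I` with `s_i = 1 / (k_i σ)` and `σ = ∑ 1 / k_j`. Tangent vectors of a space form have
nonnegative square and `m ≥ 1`, so `s_i > 0` and every `k_i` has the sign of `σ`. The number `κ =
k_i s_i = 1 / σ` does not depend on `i`, and `s_i = a_i²`.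

Everything then rests on the osculating space `E(x) = ℝ f(x) ⊕ f_* T_x M ⊕ N₁(x)`. The radial part
of the second derivative of `f` in the `i`-th factor is `-k_i s_i ⟨X, Y⟩ f_i`; its coefficient is
`-κ ⟨X, Y⟩` for all `i`, so these parts add up to a multiple of `f(x)` itself
(`exists_secondDerivAt_eq`). A derivative of a section of `N₁` has its normal part in `N₁` by
parallelism, and has no radial part because first normal vectors are orthogonal to `f_* T_x M` in
each factor separately (`factorForm_of_mem_firstNormalSpace`). Hence a frame of `E` differentiates
into `E`, so `E` is locally constant (`eventually_range_eq_of_fderiv_mem_range`), and constant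
because `M` is connected.

On the constant space `E` the `i`-th scalar product is `s_i` times the total one
(`factorForm_eq_on_osculatingSpace`). Thus, for a linear isometry `Φ` of the model ambient space
onto `E`, the `i`-th component of `Φ` divided by `a_i` preserves scalar products. These maps give
the `j_i`, their injectivity gives `m + n̄ ≤ n_i`, `g` is `x ↦ (a_1 x, …, a_ℓ x)`, and `f̄ = Φ⁻¹ ∘
f`. -/

lemma ambientForm_apply (k : ℝ) (n : ℕ) (x y : Fin (n + 1) → ℝ) :
    ambientForm k n x y =
      (if k < 0 then -1 else 1) * (x 0 * y 0) + ∑ i : Fin n, x i.succ * y i.succ := rfl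

lemma ambientForm_comm (k : ℝ) (n : ℕ) (x y : Fin (n + 1) → ℝ) :
    ambientForm k n x y = ambientForm k n y x := by
  simp only [ambientForm_apply, mul_comm]

lemma ambientForm_congr {k k' : ℝ} (h : k < 0 ↔ k' < 0) (n : ℕ) :
    ambientForm k n = ambientForm k' n := by
  ext x y
  simp [ambientForm_apply, h]

/-- Tangent vectors of a space form are spacelike. For `k < 0` this is Cauchy–Schwarz on the spatial
parts: a vector orthogonal to a timelike one cannot be timelike or null. -/
lemma ambientForm_pos {k : ℝ} (hk : k ≠ 0) {n : ℕ} {p v : Fin (n + 1) → ℝ}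
    (hp : p ∈ spaceForm k n) (hv : ambientForm k n p v = 0) (hne : v ≠ 0) :
    0 < ambientForm k n v v := by
  have hS : 0 ≤ ∑ i : Fin n, v i.succ * v i.succ :=
    Finset.sum_nonneg fun i _ => mul_self_nonneg _
  have hzero : v 0 = 0 → (∑ i : Fin n, v i.succ * v i.succ) = 0 → False := by
    intro h0 hs
    apply hne
    have := (Finset.sum_eq_zero_iff_of_nonneg
      (fun i (_ : i ∈ Finset.univ) => mul_self_nonneg (v (Fin.succ i)))).1 hs
    funext i
    refine Fin.cases h0 (fun j => ?_) i
    simpa using this j (Finset.mem_univ _)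
  rcases lt_or_gt_of_ne hk with h | h
  · obtain ⟨hpp, hp0⟩ := hp
    have hp0 := hp0 h
    have hkneg : 1 / k < 0 := one_div_neg.2 h
    have hcs := Finset.sum_mul_sq_le_sq_mul_sq Finset.univ (fun i : Fin n => p i.succ)
      (fun i : Fin n => v i.succ)
    simp only [ambientForm_apply, if_pos h] at hpp hv ⊢
    simp only [sq] at hcs
    set P := ∑ i : Fin n, p i.succ * p i.succ
    set Q := ∑ i : Fin n, v i.succ * v i.succ with hQ
    have hpv : ∑ i : Fin n, p i.succ * v i.succ = p 0 * v 0 := by linarith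
    rw [hpv] at hcs
    have hP : P < p 0 * p 0 := by linarith
    by_contra hcon
    have hQv : Q ≤ v 0 * v 0 := by linarith
    have hp2 : 0 < p 0 * p 0 := mul_pos hp0 hp0
    -- The chain `p₀² v₀² ≤ P Q < p₀² Q ≤ p₀² v₀²` is strict only if `Q > 0`, so `Q = 0` is treated
    -- apart.
    rcases hS.eq_or_lt with h0 | h0
    · refine hzero ?_ h0.symm
      rw [← h0] at hcs
      have h1 : (p 0 * v 0) * (p 0 * v 0) ≤ 0 := by linarith
      have h2 : p 0 * v 0 = 0 := mul_self_eq_zero.1 (le_antisymm h1 (mul_self_nonneg _))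
      exact (mul_eq_zero.1 h2).resolve_left hp0.ne'
    · nlinarith [mul_lt_mul_of_pos_right hP h0]
  · rw [ambientForm_apply, if_neg h.not_gt]
    rcases (mul_self_nonneg (v 0)).eq_or_lt with h0 | h0
    · rcases hS.eq_or_lt with h1 | h1
      · exact (hzero (mul_self_eq_zero.1 h0.symm) h1.symm).elim
      · linarith
    · linarith

/-- The reverse Cauchy–Schwarz inequality for two future-directed timelike vectors. -/
lemma ambientForm_neg {k : ℝ} (hk : k < 0) {n : ℕ} {p q : Fin (n + 1) → ℝ}
    (hp : ambientForm k n p p < 0) (hq : ambientForm k n q q < 0) (hp0 : 0 < p 0)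
    (hq0 : 0 < q 0) : ambientForm k n p q < 0 := by
  have hcs := Finset.sum_mul_sq_le_sq_mul_sq Finset.univ (fun i : Fin n => p i.succ)
    (fun i : Fin n => q i.succ)
  simp only [ambientForm_apply, if_pos hk] at hp hq ⊢
  simp only [sq] at hcs
  have hQ : 0 ≤ ∑ i : Fin n, q i.succ * q i.succ :=
    Finset.sum_nonneg fun i _ => mul_self_nonneg _
  set P := ∑ i : Fin n, p i.succ * p i.succ
  set Q := ∑ i : Fin n, q i.succ * q i.succ
  set S := ∑ i : Fin n, p i.succ * q i.succ
  by_contra hcon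
  have h1 : p 0 * q 0 ≤ S := by linarith
  have hpq : 0 < p 0 * q 0 := mul_pos hp0 hq0
  have h2 : (p 0 * q 0) * (p 0 * q 0) ≤ S * S := mul_self_le_mul_self hpq.le h1
  have h3 : P * Q ≤ (p 0 * p 0) * Q := mul_le_mul_of_nonneg_right (by linarith) hQ
  have h4 : (p 0 * p 0) * Q < (p 0 * p 0) * (q 0 * q 0) :=
    mul_lt_mul_of_pos_left (by linarith) (mul_pos hp0 hp0)
  nlinarith

/-- Converse of `ambientForm_neg`, applied to `-q`. It serves to check that a linear isometry keeps
the upper sheet of the hyperboloid. -/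
lemma pos_of_ambientForm_neg {k : ℝ} (hk : k < 0) {n : ℕ} {p q : Fin (n + 1) → ℝ}
    (hp : ambientForm k n p p < 0) (hq : ambientForm k n q q < 0) (hp0 : 0 < p 0)
    (hpq : ambientForm k n p q < 0) : 0 < q 0 := by
  by_contra hcon
  rcases (not_lt.1 hcon).eq_or_lt with h0 | h0
  · simp only [ambientForm_apply, if_pos hk, h0] at hq
    have : 0 ≤ ∑ i : Fin n, q i.succ * q i.succ :=
      Finset.sum_nonneg fun i _ => mul_self_nonneg _
    linarith
  · have := ambientForm_neg hk hp (q := -q) (by simpa using hq) hp0 (by simpa using h0)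
    simp only [map_neg] at this
    linarith

lemma ambientForm_single_succ (k : ℝ) (n : ℕ) (p : Fin (n + 1) → ℝ) (c : ℝ) :
    ambientForm k n p (Pi.single 0 c) = (if k < 0 then -1 else 1) * (p 0 * c) := by
  simp [ambientForm_apply]

end AmbientForm

/-! ### Scalar products of the product and of its factors -/

section ProdForm

variable {ℓ : ℕ} (k : Fin ℓ → ℝ) (n : Fin ℓ → ℕ)

/-- The scalar product of the components in the `i`-th factor. -/
noncomputable def factorForm (i : Fin ℓ) : LinearMap.BilinForm ℝ (∀ i, Fin (n i + 1) → ℝ) :=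
  (ambientForm (k i) (n i)).compl₁₂ (LinearMap.proj i) (LinearMap.proj i)

lemma factorForm_apply (i : Fin ℓ) (x y : ∀ i, Fin (n i + 1) → ℝ) :
    factorForm k n i x y = ambientForm (k i) (n i) (x i) (y i) := rfl

lemma prodForm_apply (x y : ∀ i, Fin (n i + 1) → ℝ) :
    prodForm k n x y = ∑ i, ambientForm (k i) (n i) (x i) (y i) := by
  simp [prodForm, LinearMap.sum_apply]

lemma prodForm_eq_sum (x y : ∀ i, Fin (n i + 1) → ℝ) :
    prodForm k n x y = ∑ i, factorForm k n i x y := prodForm_apply k n x y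

lemma factorForm_comm (i : Fin ℓ) (x y : ∀ i, Fin (n i + 1) → ℝ) :
    factorForm k n i x y = factorForm k n i y x := ambientForm_comm _ _ _ _

lemma prodForm_comm (x y : ∀ i, Fin (n i + 1) → ℝ) :
    prodForm k n x y = prodForm k n y x := by
  simp only [prodForm_eq_sum, factorForm_comm k n _ x y]

@[simp] lemma factorProj_same (i : Fin ℓ) (x : ∀ i, Fin (n i + 1) → ℝ) :
    factorProj n i x i = x i := by
  simp [factorProj]

lemma factorProj_ne {i j : Fin ℓ} (h : j ≠ i) (x : ∀ i, Fin (n i + 1) → ℝ) :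
    factorProj n i x j = 0 := by
  simp [factorProj, h]

lemma sum_factorProj (x : ∀ i, Fin (n i + 1) → ℝ) : ∑ i, factorProj n i x = x := by
  funext j
  rw [Finset.sum_apply, Finset.sum_eq_single j (fun i _ h => factorProj_ne n h.symm x) (by simp),
    factorProj_same]

lemma prodForm_factorProj (i : Fin ℓ) (x y : ∀ i, Fin (n i + 1) → ℝ) :
    prodForm k n x (factorProj n i y) = factorForm k n i x y := by
  rw [prodForm_apply, Finset.sum_eq_single i, factorProj_same]
  · rfl
  · intro j _ h
    rw [factorProj_ne n h, map_zero]
  · simp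

/-- The product form may be indefinite, but a tangent vector is orthogonal to the position vector in
each factor, so its components are spacelike or zero. All orthogonal projections below are therefore
genuine ones. -/
lemma prodForm_pos (hk : ∀ i, k i ≠ 0) {p v : ∀ i, Fin (n i + 1) → ℝ}
    (hp : p ∈ prodSpaceForm k n) (hv : ∀ i, factorForm k n i p v = 0) (hne : v ≠ 0) :
    0 < prodForm k n v v := by
  rw [prodForm_apply]
  obtain ⟨i, hi⟩ := Function.ne_iff.1 hne
  refine Finset.sum_pos' (fun j _ => ?_)
    ⟨i, Finset.mem_univ _, ambientForm_pos (hk i) (hp i) (hv i) hi⟩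
  by_cases h : v j = 0
  · simp [h]
  · exact (ambientForm_pos (hk j) (hp j) (hv j) h).le

end ProdForm

/-! ### Orthogonal projection onto a positive definite subspace -/

section OrthProj

variable {V : Type*} [NormedAddCommGroup V] [NormedSpace ℝ V]
  {B : LinearMap.BilinForm ℝ V} {W : Submodule ℝ V}

lemma isCompl_orthogonal_of_pos [FiniteDimensional ℝ V] (hB : ∀ x y, B x y = B y x)
    (hW : ∀ v ∈ W, v ≠ 0 → 0 < B v v) : IsCompl W (B.orthogonal W) := by
  refine LinearMap.BilinForm.isCompl_orthogonal_of_restrict_nondegenerate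
    (fun x y h => by rw [hB, h]) ?_
  constructor
  · rintro ⟨v, hv⟩ h
    by_contra hne
    exact (hW v hv (fun h0 => hne (Subtype.ext h0))).ne' (h ⟨v, hv⟩)
  · rintro ⟨v, hv⟩ h
    by_contra hne
    exact (hW v hv (fun h0 => hne (Subtype.ext h0))).ne' (h ⟨v, hv⟩)

lemma orthProj_mem (B : LinearMap.BilinForm ℝ V) (W : Submodule ℝ V) (v : V) :
    orthProj B W v ∈ W := by
  unfold orthProj
  split_ifs with h
  · exact Submodule.projection_apply_mem h v
  · simp

/-- No nondegeneracy is needed: when the projection does not exist, the default value is `0` as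
well. -/
lemma orthProj_eq_zero {v : V} (hv : v ∈ B.orthogonal W) : orthProj B W v = 0 := by
  unfold orthProj
  split_ifs with h
  · exact (Submodule.projection_apply_eq_zero_iff h).2 hv
  · simp

lemma sub_orthProj_mem [FiniteDimensional ℝ V] (hB : ∀ x y, B x y = B y x)
    (hW : ∀ v ∈ W, v ≠ 0 → 0 < B v v) (v : V) : v - orthProj B W v ∈ B.orthogonal W := by
  have h := isCompl_orthogonal_of_pos hB hW
  unfold orthProj
  rw [dif_pos h, ← Submodule.projection_apply_eq_zero_iff h, map_sub, sub_eq_zero]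
  exact (Submodule.projection_apply_of_mem_left h (Submodule.projection_apply_mem h v)).symm

end OrthProj

/-! ### Tangent spaces of space forms and of their products -/

section Tangent

lemma exists_curve_spaceForm {k : ℝ} (hk : k ≠ 0) {n : ℕ} {p v : Fin (n + 1) → ℝ}
    (hp : p ∈ spaceForm k n) (hv : ambientForm k n p v = 0) :
    ∃ γ : ℝ → Fin (n + 1) → ℝ, ContDiffAt ℝ ∞ γ 0 ∧ (∀ᶠ t in 𝓝 0, γ t ∈ spaceForm k n) ∧
      γ 0 = p ∧ HasDerivAt γ v 0 := by
  -- The curve is `p + t v` rescaled onto the quadric: `⟨p + t v, p + t v⟩ = 1/k + t² ⟨v, v⟩ = (1 +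
  -- c t²) / k`.
  set c : ℝ := k * ambientForm k n v v with hc
  have hcont : Continuous fun t : ℝ => 1 + c * t ^ 2 := by fun_prop
  have hpos : ∀ᶠ t : ℝ in 𝓝 0, 0 < 1 + c * t ^ 2 :=
    continuousAt_const.eventually_lt hcont.continuousAt (by simp)
  have hφs : ContDiffAt ℝ ∞ (fun t : ℝ => (Real.sqrt (1 + c * t ^ 2))⁻¹) 0 := by
    refine ContDiffAt.inv (ContDiffAt.sqrt (by fun_prop) (by simp)) (by simp)
  have hφd : HasDerivAt (fun t : ℝ => (Real.sqrt (1 + c * t ^ 2))⁻¹) 0 0 := by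
    have h1 : HasDerivAt (fun t : ℝ => 1 + c * t ^ 2) 0 0 := by
      simpa using ((hasDerivAt_pow 2 (0 : ℝ)).const_mul c).const_add 1
    simpa using (h1.sqrt (by simp)).fun_inv (by simp)
  have hld : HasDerivAt (fun t : ℝ => p + t • v) v 0 := by
    simpa using ((hasDerivAt_id (0 : ℝ)).smul_const v).const_add p
  have hγd : HasDerivAt (fun t : ℝ => (Real.sqrt (1 + c * t ^ 2))⁻¹ • (p + t • v)) v 0 := by
    simpa only [mul_zero, zero_smul, add_zero, ne_eq, OfNat.ofNat_ne_zero, not_false_eq_true,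
      zero_pow, Real.sqrt_one, inv_one, one_smul] using hφd.fun_smul hld
  refine ⟨_, hφs.smul (by fun_prop), ?_, by simp, hγd⟩
  have h0 : k < 0 → ∀ᶠ t : ℝ in 𝓝 0, 0 < ((Real.sqrt (1 + c * t ^ 2))⁻¹ • (p + t • v)) 0 := by
    intro hneg
    have hc0 : ContinuousAt (fun t : ℝ => ((Real.sqrt (1 + c * t ^ 2))⁻¹ • (p + t • v)) 0) 0 :=
      (continuous_apply 0).continuousAt.comp hγd.continuousAt
    exact continuousAt_const.eventually_lt hc0 (by simpa using hp.2 hneg)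
  have h0' : ∀ᶠ t : ℝ in 𝓝 0,
      k < 0 → 0 < ((Real.sqrt (1 + c * t ^ 2))⁻¹ • (p + t • v)) 0 := by
    by_cases h : k < 0
    · filter_upwards [h0 h] with t ht _ using ht
    · exact Filter.Eventually.of_forall fun t h' => (h h').elim
  filter_upwards [hpos, h0'] with t ht ht0
  refine ⟨?_, ht0⟩
  have hvp : ambientForm k n v p = 0 := by rw [ambientForm_comm, hv]
  have hs : (Real.sqrt (1 + c * t ^ 2))⁻¹ * (Real.sqrt (1 + c * t ^ 2))⁻¹ =
      (1 + c * t ^ 2)⁻¹ := by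
    rw [← mul_inv, Real.mul_self_sqrt ht.le]
  change ambientForm k n ((Real.sqrt (1 + c * t ^ 2))⁻¹ • (p + t • v))
    ((Real.sqrt (1 + c * t ^ 2))⁻¹ • (p + t • v)) = 1 / k
  simp only [map_smul, map_add, LinearMap.smul_apply, LinearMap.add_apply, smul_eq_mul, hv, hvp,
    hp.1]
  have hring : ∀ r q : ℝ, r * (r * (1 / k + t * 0) + t * (r * (0 + t * q))) =
      (r * r) * (1 / k + t ^ 2 * q) := fun r q => by ring
  rw [hring, hs, inv_mul_eq_iff_eq_mul₀ ht.ne', hc]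
  field_simp

lemma hasDerivAt_ambientForm {k : ℝ} {n : ℕ} {γ : ℝ → Fin (n + 1) → ℝ}
    {v : Fin (n + 1) → ℝ} (h : HasDerivAt γ v 0) :
    HasDerivAt (fun t => ambientForm k n (γ t) (γ t)) (2 * ambientForm k n (γ 0) v) 0 := by
  have hi : ∀ i, HasDerivAt (fun t => γ t i) (v i) 0 := hasDerivAt_pi.1 h
  simp only [ambientForm_apply]
  refine ((((hi 0).mul (hi 0)).const_mul _).add
    (HasDerivAt.fun_sum fun (i : Fin n) _ => (hi i.succ).mul (hi i.succ))).congr_deriv ?_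
  rw [mul_add 2, Finset.mul_sum]
  congr 1
  · ring
  · exact Finset.sum_congr rfl fun i _ => by ring

lemma ambientForm_eq_zero_of_curve {k : ℝ} {n : ℕ} {γ : ℝ → Fin (n + 1) → ℝ}
    {v : Fin (n + 1) → ℝ} (h : HasDerivAt γ v 0) (hS : ∀ᶠ t in 𝓝 0, γ t ∈ spaceForm k n) :
    ambientForm k n (γ 0) v = 0 := by
  have h1 : HasDerivAt (fun t => ambientForm k n (γ t) (γ t)) 0 0 := by
    refine (hasDerivAt_const (0 : ℝ) (1 / k)).congr_of_eventuallyEq ?_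
    filter_upwards [hS] with t ht using ht.1
  have := (hasDerivAt_ambientForm h).unique h1
  linarith

lemma mem_tangentSpaceAt_spaceForm {k : ℝ} (hk : k ≠ 0) {n : ℕ} {p : Fin (n + 1) → ℝ}
    (hp : p ∈ spaceForm k n) (v : Fin (n + 1) → ℝ) :
    v ∈ tangentSpaceAt (spaceForm k n) p ↔ ambientForm k n p v = 0 := by
  constructor
  · intro h
    refine Submodule.span_induction ?_ (by simp) (fun x y _ _ hx hy => by simp [hx, hy])
      (fun a x _ hx => by simp [hx]) h
    rintro v ⟨γ, hγ, hS, rfl, rfl⟩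
    exact ambientForm_eq_zero_of_curve (hγ.differentiableAt (by simp)).hasDerivAt hS
  · intro h
    obtain ⟨γ, hγ, hS, h0, hd⟩ := exists_curve_spaceForm hk hp h
    exact Submodule.subset_span ⟨γ, hγ, hS, h0, hd.deriv⟩

lemma mem_tangentSpaceAt_prodSpaceForm {ℓ : ℕ} {k : Fin ℓ → ℝ} {n : Fin ℓ → ℕ}
    (hk : ∀ i, k i ≠ 0) {p : ∀ i, Fin (n i + 1) → ℝ} (hp : p ∈ prodSpaceForm k n)
    (v : ∀ i, Fin (n i + 1) → ℝ) :
    v ∈ tangentSpaceAt (prodSpaceForm k n) p ↔ ∀ i, factorForm k n i p v = 0 := by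
  constructor
  · intro h i
    refine Submodule.span_induction ?_ (by simp) (fun x y _ _ hx hy => by simp [hx, hy])
      (fun a x _ hx => by simp [hx]) h
    rintro v ⟨γ, hγ, hS, rfl, rfl⟩
    refine ambientForm_eq_zero_of_curve (γ := fun t => γ t i)
      (hasDerivAt_pi.1 (hγ.differentiableAt (by simp)).hasDerivAt i) ?_
    filter_upwards [hS] with t ht using ht i
  · intro h
    choose γ hγ hS h0 hd using fun i => exists_curve_spaceForm (hk i) (hp i) (h i)
    refine Submodule.subset_span ⟨fun t i => γ i t, contDiffAt_pi.2 hγ, ?_, funext h0,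
      (hasDerivAt_pi.2 hd).deriv⟩
    filter_upwards [Filter.eventually_all.2 hS] with t ht using ht

end Tangent

/-! ### Calculus in normed spaces -/

section Calculus

variable {E : Type*} [NormedAddCommGroup E] [NormedSpace ℝ E]
  {V : Type*} [NormedAddCommGroup V] [NormedSpace ℝ V]

/-- A smooth moving frame whose derivatives stay in its span has a locally constant span. -/
lemma eventually_range_eq_of_fderiv_mem_range [FiniteDimensional ℝ V]
    {D : Type*} [NormedAddCommGroup D] [NormedSpace ℝ D] [FiniteDimensional ℝ D]
    [CompleteSpace D] {e : E → D →L[ℝ] V} {U : Set E} (hU : IsOpen U)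
    (he : DifferentiableOn ℝ e U) {z₀ : E} (hz₀ : z₀ ∈ U) (hinj : Function.Injective (e z₀))
    (hd : ∀ z ∈ U, ∀ h d, fderiv ℝ e z h d ∈ LinearMap.range (e z : D →ₗ[ℝ] V)) :
    ∀ᶠ z in 𝓝 z₀, LinearMap.range (e z : D →ₗ[ℝ] V) = LinearMap.range (e z₀ : D →ₗ[ℝ] V) := by
  obtain ⟨P₀, hP₀⟩ := LinearMap.exists_leftInverse_of_injective (e z₀ : D →ₗ[ℝ] V)
    (LinearMap.ker_eq_bot.2 hinj)
  set P : V →L[ℝ] D := LinearMap.toContinuousLinearMap P₀ with hP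
  have hG₀ : P ∘L e z₀ = 1 := by
    ext d
    exact LinearMap.congr_fun hP₀ d
  have hcont : ContinuousAt (fun z => P ∘L e z) z₀ :=
    ((ContinuousLinearMap.compL ℝ D V D P).continuous.continuousAt).comp
      ((he z₀ hz₀).differentiableAt (hU.mem_nhds hz₀)).continuousAt
  have hunit : ∀ᶠ z in 𝓝 z₀, IsUnit (P ∘L e z) :=
    hcont.eventually (Units.isOpen.mem_nhds (by simp [hG₀]))
  obtain ⟨r, hr, hball⟩ := Metric.eventually_nhds_iff_ball.1
    (hunit.and (hU.eventually_mem hz₀))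
  -- The frame is normalised so that `P ∘ K = 1` while the span is unchanged. Then `K'` takes values
  -- in the span of `K` and is killed by `P`, which is injective there; hence `K' = 0`.
  set K : E → D →L[ℝ] V := fun z => e z ∘L Ring.inverse (P ∘L e z) with hK
  have hPK : ∀ z ∈ Metric.ball z₀ r, P ∘L K z = 1 := fun z hz =>
    Ring.mul_inverse_cancel _ (hball z hz).1
  have hrange : ∀ z ∈ Metric.ball z₀ r,
      LinearMap.range (K z : D →ₗ[ℝ] V) = LinearMap.range (e z : D →ₗ[ℝ] V) := by
    intro z hz
    apply le_antisymm
    · rintro _ ⟨d, rfl⟩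
      exact ⟨Ring.inverse (P ∘L e z) d, rfl⟩
    · rintro _ ⟨d, rfl⟩
      refine ⟨(P ∘L e z) d, ?_⟩
      have := congrArg (fun T : D →L[ℝ] D => T d) (Ring.inverse_mul_cancel _ (hball z hz).1)
      exact congrArg (e z) this
  have hdiff : ∀ z ∈ Metric.ball z₀ r, ∃ K' : E →L[ℝ] D →L[ℝ] V, HasFDerivAt K K' z ∧
      ∀ h d, K' h d ∈ LinearMap.range (e z : D →ₗ[ℝ] V) := by
    intro z hz
    have h1 := ((he z (hball z hz).2).differentiableAt (hU.mem_nhds (hball z hz).2)).hasFDerivAt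
    have h2 : HasFDerivAt (fun z => P ∘L e z) ((ContinuousLinearMap.compL ℝ D V D P) ∘L
        fderiv ℝ e z) z := (ContinuousLinearMap.compL ℝ D V D P).hasFDerivAt.comp z h1
    have h3 := (differentiableAt_inverse (𝕜 := ℝ) (hball z hz).1).hasFDerivAt.comp z h2
    refine ⟨_, h1.clm_comp h3, fun h d => ?_⟩
    refine Submodule.add_mem _ ⟨_, rfl⟩ ?_
    exact hd z (hball z hz).2 h _
  have hK0 : ∀ z ∈ Metric.ball z₀ r, fderiv ℝ K z = 0 := by
    intro z hz
    obtain ⟨K', hK', hmem⟩ := hdiff z hz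
    have hPK' : (ContinuousLinearMap.compL ℝ D V D P) ∘L K' = 0 := by
      refine ((ContinuousLinearMap.compL ℝ D V D P).hasFDerivAt.comp z hK').unique ?_
      refine (hasFDerivAt_const (1 : D →L[ℝ] D) z).congr_of_eventuallyEq ?_
      filter_upwards [Metric.isOpen_ball.mem_nhds hz] with y hy using hPK y hy
    rw [hK'.fderiv]
    ext h d
    have hm := hmem h d
    rw [← hrange z hz] at hm
    obtain ⟨w, hw⟩ := hm
    have h0 : P (K' h d) = 0 := by
      simpa using congrArg (fun T : E →L[ℝ] D →L[ℝ] D => T h d) hPK'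
    have h1 : P (K z w) = w := congrArg (fun T : D →L[ℝ] D => T w) (hPK z hz)
    change K z w = _ at hw
    rw [hw, h0] at h1
    rw [← hw, ← h1]
    simp
  filter_upwards [Metric.ball_mem_nhds z₀ hr] with z hz
  have hconst : K z = K z₀ := Metric.isOpen_ball.is_const_of_fderiv_eq_zero
    (convex_ball z₀ r).isPreconnected
    (fun y hy => (hdiff y hy).choose_spec.1.differentiableAt.differentiableWithinAt)
    hK0 hz (Metric.mem_ball_self hr)
  rw [← hrange z hz, hconst, hrange z₀ (Metric.mem_ball_self hr)]

variable [FiniteDimensional ℝ V]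

lemma HasFDerivAt.bilinForm_eq_zero (C : LinearMap.BilinForm ℝ V) {u v : E → V}
    {u' v' : E →L[ℝ] V} {z : E} {c : ℝ} (hu : HasFDerivAt u u' z) (hv : HasFDerivAt v v' z)
    (hc : ∀ᶠ y in 𝓝 z, C (u y) (v y) = c) (h : E) : C (u' h) (v z) + C (u z) (v' h) = 0 := by
  have h1 := ContinuousLinearMap.hasFDerivAt_of_bilinear
    (LinearMap.toContinuousBilinearMap C) hu hv
  have h2 := h1.unique ((hasFDerivAt_const c z).congr_of_eventuallyEq hc)
  have := congrArg (fun T : E →L[ℝ] ℝ => T h) h2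
  simp at this
  linarith

lemma LinearMap.BilinForm.eq_zero_of_hasFDerivAt (C : LinearMap.BilinForm ℝ V) {v : E → V}
    {v' : E →L[ℝ] V} {z : E} (w : V) (hv : HasFDerivAt v v' z)
    (hc : ∀ᶠ y in 𝓝 z, C w (v y) = 0) (h : E) : C w (v' h) = 0 := by
  simpa using HasFDerivAt.bilinForm_eq_zero C (hasFDerivAt_const w z) hv hc h

omit [FiniteDimensional ℝ V] in
lemma ContDiffAt.hasFDerivAt_fderiv {F : E → V} {z : E} (hF : ContDiffAt ℝ ∞ F z) :
    HasFDerivAt (fderiv ℝ F) (fderiv ℝ (fderiv ℝ F) z) z :=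
  ((hF.fderiv_right (m := ∞) (by simp)).differentiableAt (by simp)).hasFDerivAt

omit [FiniteDimensional ℝ V] in
lemma ContDiffAt.hasFDerivAt_fderiv_apply {F : E → V} {z : E} (hF : ContDiffAt ℝ ∞ F z) (a : E) :
    HasFDerivAt (fun y => fderiv ℝ F y a) ((fderiv ℝ (fderiv ℝ F) z).flip a) z := by
  simpa using hF.hasFDerivAt_fderiv.clm_apply (hasFDerivAt_const a z)

/-- If a symmetric form vanishes on the tangent spaces of `F`, then the second derivative of `F`
is orthogonal to them. -/
lemma bilinForm_second_deriv_eq_zero (C : LinearMap.BilinForm ℝ V) (hC : ∀ x y, C x y = C y x)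
    {F : E → V} {z : E} (hF : ContDiffAt ℝ ∞ F z)
    (h0 : ∀ a b, ∀ᶠ y in 𝓝 z, C (fderiv ℝ F y a) (fderiv ℝ F y b) = 0) (a b c : E) :
    C (fderiv ℝ (fderiv ℝ F) z a b) (fderiv ℝ F z c) = 0 := by
  have hsym : ∀ a b, fderiv ℝ (fderiv ℝ F) z a b = fderiv ℝ (fderiv ℝ F) z b a := fun a b =>
    (hF.isSymmSndFDerivAt (by simpa using WithTop.coe_le_coe.2 (le_top (a := (2 : ℕ∞))))).eq a b
  -- As in the Koszul formula: `C (F_ab, F_c)` is symmetric in `a, b` by symmetry of second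
  -- derivatives, and skew in `b, c` by differentiating the hypothesis. The two symmetries force it
  -- to vanish.
  have key : ∀ a b c, C (fderiv ℝ (fderiv ℝ F) z a b) (fderiv ℝ F z c) +
      C (fderiv ℝ (fderiv ℝ F) z a c) (fderiv ℝ F z b) = 0 := by
    intro a b c
    have := HasFDerivAt.bilinForm_eq_zero C (hF.hasFDerivAt_fderiv_apply b)
      (hF.hasFDerivAt_fderiv_apply c) (h0 b c) a
    rwa [hC (fderiv ℝ F z b)] at this
  have h1 := key a b c
  have h2 := key b c a
  have h3 := key c a b
  rw [hsym b a] at h2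
  rw [hsym c b, hsym c a] at h3
  linarith

omit [FiniteDimensional ℝ V] in
lemma second_deriv_comp {E' : Type*} [NormedAddCommGroup E'] [NormedSpace ℝ E'] {F : E → V}
    {G : E' → V} {τ : E → E'} {z : E} (hG : ContDiffAt ℝ ∞ G (τ z)) (hτ : ContDiffAt ℝ ∞ τ z)
    (h : F =ᶠ[𝓝 z] G ∘ τ) (a b : E) :
    fderiv ℝ (fderiv ℝ F) z a b =
      fderiv ℝ (fderiv ℝ G) (τ z) (fderiv ℝ τ z a) (fderiv ℝ τ z b) +
        fderiv ℝ G (τ z) (fderiv ℝ (fderiv ℝ τ) z a b) := by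
  have hGd : ∀ᶠ y in 𝓝 (τ z), DifferentiableAt ℝ G y := by
    filter_upwards [(hG.of_le (m := 1) (by simp)).eventually (by simp)] with y hy
    exact hy.differentiableAt (by simp)
  have hτd : ∀ᶠ y in 𝓝 z, DifferentiableAt ℝ τ y := by
    filter_upwards [(hτ.of_le (m := 1) (by simp)).eventually (by simp)] with y hy
    exact hy.differentiableAt (by simp)
  have h1 : fderiv ℝ F =ᶠ[𝓝 z] fun y => (fderiv ℝ G (τ y)) ∘L fderiv ℝ τ y := by
    filter_upwards [h.eventuallyEq_nhds, hτ.continuousAt.eventually hGd, hτd] with y hy hGy hτy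
    rw [hy.fderiv_eq]
    exact fderiv_comp y hGy hτy
  have h2 : HasFDerivAt (fun y => fderiv ℝ G (τ y))
      (fderiv ℝ (fderiv ℝ G) (τ z) ∘L fderiv ℝ τ z) z :=
    hG.hasFDerivAt_fderiv.comp z hτd.self_of_nhds.hasFDerivAt
  rw [((h2.clm_comp hτ.hasFDerivAt_fderiv).congr_of_eventuallyEq h1).fderiv]
  simp [add_comm]

end Calculus

/-! ### Derivatives of maps on a manifold, read in a chart -/

section Charts

variable {m : ℕ} {M : Type*} [TopologicalSpace M] [ChartedSpace (EuclideanSpace ℝ (Fin m)) M]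
  [IsManifold (𝓡 m) ∞ M] {V : Type*} [NormedAddCommGroup V] [NormedSpace ℝ V]

lemma ContMDiffOn.contDiffOn_comp_extChartAt_symm {F : M → V} {U : Set M}
    (hF : ContMDiffOn (𝓡 m) 𝓘(ℝ, V) ∞ F U) (x₀ : M) :
    ContDiffOn ℝ ∞ (F ∘ (extChartAt (𝓡 m) x₀).symm)
      ((extChartAt (𝓡 m) x₀).target ∩ (extChartAt (𝓡 m) x₀).symm ⁻¹' U) := by
  rw [← contMDiffOn_iff_contDiffOn]
  exact hF.comp ((contMDiffOn_extChartAt_symm x₀).mono Set.inter_subset_left)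
    Set.inter_subset_right

lemma ContMDiff.contDiffAt_comp_extChartAt_symm {F : M → V}
    (hF : ContMDiff (𝓡 m) 𝓘(ℝ, V) ∞ F) (x₀ : M) {z : EuclideanSpace ℝ (Fin m)}
    (hz : z ∈ (extChartAt (𝓡 m) x₀).target) :
    ContDiffAt ℝ ∞ (F ∘ (extChartAt (𝓡 m) x₀).symm) z := by
  have h := (hF.contMDiffOn (s := Set.univ)).contDiffOn_comp_extChartAt_symm x₀
  rw [Set.preimage_univ, Set.inter_univ] at h
  exact h.contDiffAt ((isOpen_extChartAt_target x₀).mem_nhds hz)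

lemma mdifferentiableAt_extChartAt_symm' (x₀ : M) {z : EuclideanSpace ℝ (Fin m)}
    (hz : z ∈ (extChartAt (𝓡 m) x₀).target) :
    MDifferentiableAt 𝓘(ℝ, EuclideanSpace ℝ (Fin m)) (𝓡 m) (extChartAt (𝓡 m) x₀).symm z :=
  ((contMDiffOn_extChartAt_symm (n := ∞) x₀).contMDiffAt
    ((isOpen_extChartAt_target x₀).mem_nhds hz)).mdifferentiableAt (by simp)

/-- Derivatives in a chart are values of the differential. -/
lemma exists_fderiv_chart_eq (x₀ : M) {z : EuclideanSpace ℝ (Fin m)}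
    (hz : z ∈ (extChartAt (𝓡 m) x₀).target) (h : EuclideanSpace ℝ (Fin m)) :
    ∃ X, ∀ {F : M → V},
      MDifferentiableAt (𝓡 m) 𝓘(ℝ, V) F ((extChartAt (𝓡 m) x₀).symm z) →
      fderiv ℝ (F ∘ (extChartAt (𝓡 m) x₀).symm) z h =
        differentialAt m F ((extChartAt (𝓡 m) x₀).symm z) X := by
  refine ⟨mfderiv 𝓘(ℝ, EuclideanSpace ℝ (Fin m)) (𝓡 m) (extChartAt (𝓡 m) x₀).symm z h,
    fun {F} hF => ?_⟩
  rw [← mfderiv_eq_fderiv, mfderiv_comp z hF (mdifferentiableAt_extChartAt_symm' x₀ hz)]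
  rfl

/-- Values of the differential are derivatives in a chart. -/
lemma exists_differentialAt_eq (x₀ : M) {y : M} (hy : y ∈ (extChartAt (𝓡 m) x₀).source)
    (X : TangentSpace (𝓡 m) y) :
    ∃ h, ∀ {F : M → V}, MDifferentiableAt (𝓡 m) 𝓘(ℝ, V) F y →
      differentialAt m F y X =
        fderiv ℝ (F ∘ (extChartAt (𝓡 m) x₀).symm) (extChartAt (𝓡 m) x₀ y) h := by
  -- The witness depends on `X` only, so one `h` serves both `f` and a normal section.
  refine ⟨mfderiv (𝓡 m) 𝓘(ℝ, EuclideanSpace ℝ (Fin m)) (extChartAt (𝓡 m) x₀) y X,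
    fun {F} hF => ?_⟩
  have hinv := (extChartAt (𝓡 m) x₀).left_inv hy
  have hz := (extChartAt (𝓡 m) x₀).map_source hy
  have hc : F =ᶠ[𝓝 y] (F ∘ (extChartAt (𝓡 m) x₀).symm) ∘ extChartAt (𝓡 m) x₀ := by
    filter_upwards [(isOpen_extChartAt_source (I := 𝓡 m) x₀).mem_nhds hy] with w hw
    exact congrArg F ((extChartAt (𝓡 m) x₀).left_inv hw).symm
  have h1 : MDifferentiableAt 𝓘(ℝ, EuclideanSpace ℝ (Fin m)) 𝓘(ℝ, V)
      (F ∘ (extChartAt (𝓡 m) x₀).symm) (extChartAt (𝓡 m) x₀ y) :=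
    MDifferentiableAt.comp _ (hinv.symm ▸ hF) (mdifferentiableAt_extChartAt_symm' x₀ hz)
  have h2 := mfderiv_comp y h1 (mdifferentiableAt_extChartAt (I := 𝓡 m)
    (by rwa [extChartAt_source] at hy))
  unfold differentialAt
  rw [hc.mfderiv_eq, h2, ← mfderiv_eq_fderiv]
  rfl

lemma range_fderiv_chart {F : M → V} (hF : ContMDiff (𝓡 m) 𝓘(ℝ, V) ∞ F) (x₀ : M)
    {z : EuclideanSpace ℝ (Fin m)} (hz : z ∈ (extChartAt (𝓡 m) x₀).target) :
    LinearMap.range (fderiv ℝ (F ∘ (extChartAt (𝓡 m) x₀).symm) z).toLinearMap =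
      LinearMap.range (differentialAt m F ((extChartAt (𝓡 m) x₀).symm z)) := by
  apply le_antisymm
  · rintro _ ⟨h, rfl⟩
    obtain ⟨X, hX⟩ := exists_fderiv_chart_eq (V := V) x₀ hz h
    exact ⟨X, (hX (hF.mdifferentiable (by simp) _)).symm⟩
  · rintro _ ⟨X, rfl⟩
    obtain ⟨h, hh⟩ := exists_differentialAt_eq (V := V) x₀
      ((extChartAt (𝓡 m) x₀).map_target hz) X
    refine ⟨h, ?_⟩
    rw [hh (hF.mdifferentiable (by simp) _), (extChartAt (𝓡 m) x₀).right_inv hz]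
    rfl

/-- The second derivative in any chart differs from the one in the preferred chart by a
tangential term. -/
lemma exists_second_deriv_chart_eq {F : M → V} (hF : ContMDiff (𝓡 m) 𝓘(ℝ, V) ∞ F) (x₀ : M)
    {z : EuclideanSpace ℝ (Fin m)} (hz : z ∈ (extChartAt (𝓡 m) x₀).target)
    (a b : EuclideanSpace ℝ (Fin m)) :
    ∃ X Y Z : TangentSpace (𝓡 m) ((extChartAt (𝓡 m) x₀).symm z),
      fderiv ℝ (fderiv ℝ (F ∘ (extChartAt (𝓡 m) x₀).symm)) z a b =
        secondDerivAt m F ((extChartAt (𝓡 m) x₀).symm z) X Y +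
          differentialAt m F ((extChartAt (𝓡 m) x₀).symm z) Z := by
  set y := (extChartAt (𝓡 m) x₀).symm z with hy
  -- `τ` is the change of chart. In the chain rule for second derivatives, the term containing the
  -- second derivative of `τ` is tangential; it supplies `Z`.
  set τ := extChartAt (𝓡 m) y ∘ (extChartAt (𝓡 m) x₀).symm with hτdef
  have hsymm := (contMDiffOn_extChartAt_symm (I := 𝓡 m) (n := ∞) x₀).contMDiffAt
    ((isOpen_extChartAt_target x₀).mem_nhds hz)
  have hτ : ContDiffAt ℝ ∞ τ z := by
    rw [← contMDiffAt_iff_contDiffAt]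
    exact ContMDiffAt.comp z (contMDiffAt_extChartAt (I := 𝓡 m)) hsymm
  have hmem : extChartAt (𝓡 m) y y ∈ (extChartAt (𝓡 m) y).target := mem_extChartAt_target y
  have heq : F ∘ (extChartAt (𝓡 m) x₀).symm =ᶠ[𝓝 z]
      (F ∘ (extChartAt (𝓡 m) y).symm) ∘ τ := by
    have : ∀ᶠ w in 𝓝 z, (extChartAt (𝓡 m) x₀).symm w ∈ (extChartAt (𝓡 m) y).source :=
      hsymm.continuousAt.eventually
        ((isOpen_extChartAt_source (I := 𝓡 m) y).mem_nhds (mem_extChartAt_source y))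
    filter_upwards [this] with w hw
    exact congrArg F ((extChartAt (𝓡 m) y).left_inv hw).symm
  have hsnd := second_deriv_comp (τ := τ) (z := z)
    (hF.contDiffAt_comp_extChartAt_symm y hmem) hτ heq a b
  obtain ⟨Z, hZ⟩ := exists_fderiv_chart_eq (V := V) y hmem (fderiv ℝ (fderiv ℝ τ) z a b)
  rw [(extChartAt (𝓡 m) y).left_inv (mem_extChartAt_source y)] at hZ
  refine ⟨fderiv ℝ τ z a, fderiv ℝ τ z b, Z, ?_⟩
  rw [hsnd]
  congr 1
  exact hZ (hF.mdifferentiable (by simp) _)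

end Charts

/-! ### Isometric immersions into products of space forms -/

section ProductImmersion

variable {ℓ : ℕ} {k : Fin ℓ → ℝ} {n : Fin ℓ → ℕ}

lemma factorForm_self (k : Fin ℓ → ℝ) (n : Fin ℓ → ℕ) {p : ∀ i, Fin (n i + 1) → ℝ}
    (hp : p ∈ prodSpaceForm k n) (i : Fin ℓ) : factorForm k n i p p = 1 / k i := (hp i).1

/-- The decomposition of a vector into its normal, tangential and radial components. -/
lemma exists_eq_orthProj_add (hk : ∀ i, k i ≠ 0) {p : ∀ i, Fin (n i + 1) → ℝ}
    (hp : p ∈ prodSpaceForm k n) {T : Type*} [AddCommGroup T] [Module ℝ T]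
    (L : T →ₗ[ℝ] ∀ i, Fin (n i + 1) → ℝ) (hL : ∀ X i, factorForm k n i p (L X) = 0)
    (v : ∀ i, Fin (n i + 1) → ℝ) :
    ∃ X, v = orthProj (prodForm k n) (tangentSpaceAt (prodSpaceForm k n) p ⊓
        (prodForm k n).orthogonal (LinearMap.range L)) v + L X +
      ∑ i, (k i * factorForm k n i p v) • factorProj n i p := by
  set B := prodForm k n with hB
  set N := tangentSpaceAt (prodSpaceForm k n) p ⊓ B.orthogonal (LinearMap.range L) with hN
  have hT := mem_tangentSpaceAt_prodSpaceForm hk hp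
  have hcomm := prodForm_comm k n
  have hpos : ∀ v ∈ N, v ≠ 0 → 0 < B v v := fun v hv hne =>
    prodForm_pos k n hk hp ((hT v).1 hv.1) hne
  have hposL : ∀ v ∈ LinearMap.range L, v ≠ 0 → 0 < B v v := by
    rintro _ ⟨X, rfl⟩ hne
    exact prodForm_pos k n hk hp (hL X) hne
  have hradial : ∀ u, (∀ i, factorForm k n i p u = 0) →
      ∀ c : Fin ℓ → ℝ, B u (∑ i, c i • factorProj n i p) = 0 := by
    intro u hu c
    rw [map_sum]
    refine Finset.sum_eq_zero fun i _ => ?_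
    rw [map_smul, hB, prodForm_factorProj, factorForm_comm, hu, smul_zero]
  set u := orthProj B N v with hu
  have huN : u ∈ N := orthProj_mem _ _ _
  set c : Fin ℓ → ℝ := fun i => k i * factorForm k n i p v with hc
  -- What remains after the normal and radial parts are removed must be tangential. Its defect `w -
  -- t` lies in `N` and is orthogonal both to `N` and to the range of `L`, so it has square zero and
  -- vanishes by positivity.
  set w := v - u - ∑ i, c i • factorProj n i p with hw
  have hsumcomp : ∀ i, factorForm k n i p (∑ j, c j • factorProj n j p) = c i / k i := by
    intro i
    rw [map_sum, Finset.sum_eq_single i]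
    · rw [map_smul, factorForm_apply, factorProj_same, (hp i).1, smul_eq_mul]
      ring
    · intro j _ hj
      rw [map_smul, factorForm_apply, factorProj_ne n hj.symm, map_zero, smul_zero]
    · simp
  have hwT : ∀ i, factorForm k n i p w = 0 := by
    intro i
    rw [hw, map_sub, map_sub, hsumcomp, (hT u).1 huN.1 i, hc]
    field_simp [hk i]
    ring
  have hwN : ∀ x ∈ N, B x w = 0 := by
    intro x hx
    rw [hw, map_sub, hradial x ((hT x).1 hx.1), sub_zero]
    exact LinearMap.BilinForm.mem_orthogonal_iff.1 (sub_orthProj_mem hcomm hpos v) x hx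
  set t := orthProj B (LinearMap.range L) w with ht
  obtain ⟨X, hX⟩ : t ∈ LinearMap.range L := orthProj_mem _ _ _
  have hperp : w - t ∈ B.orthogonal (LinearMap.range L) := sub_orthProj_mem hcomm hposL w
  have htT : ∀ i, factorForm k n i p t = 0 := fun i => by rw [← hX]; exact hL X i
  have hdT : ∀ i, factorForm k n i p (w - t) = 0 := fun i => by
    rw [map_sub, hwT, htT, sub_zero]
  have hdN : w - t ∈ N := ⟨(hT _).2 hdT, hperp⟩
  have hd0 : w - t = 0 := by
    by_contra hne
    refine (hpos _ hdN hne).ne' ?_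
    rw [map_sub, hwN _ hdN, hcomm (w - t) t, zero_sub, neg_eq_zero]
    exact LinearMap.BilinForm.mem_orthogonal_iff.1 hperp t ⟨X, hX⟩
  refine ⟨X, ?_⟩
  rw [hX, ← sub_eq_zero.1 hd0, hw]
  abel

variable {m : ℕ} {M : Type*} [TopologicalSpace M] [ChartedSpace (EuclideanSpace ℝ (Fin m)) M]

/-- The map into the ambient space underlying a map into a product of space forms. -/
abbrev ambientMap (f : M → prodSpaceForm k n) : M → ∀ i, Fin (n i + 1) → ℝ :=
  fun y => (f y : ∀ i, Fin (n i + 1) → ℝ)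

/-- The span of the position vector, the tangent space and the first normal space. -/
noncomputable def osculatingSpace (m : ℕ) {M : Type*} [TopologicalSpace M]
    [ChartedSpace (EuclideanSpace ℝ (Fin m)) M] [IsManifold (𝓡 m) ∞ M]
    (f : M → prodSpaceForm k n) (x : M) :
    Submodule ℝ (∀ i, Fin (n i + 1) → ℝ) :=
  Submodule.span ℝ {ambientMap f x} ⊔ LinearMap.range (differentialAt m (ambientMap f) x) ⊔
    firstNormalSpace m (prodForm k n) f x

variable [IsManifold (𝓡 m) ∞ M] {f : M → prodSpaceForm k n}

lemma ambientMap_mem_osculatingSpace (x : M) : ambientMap f x ∈ osculatingSpace m f x :=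
  Submodule.mem_sup_left (Submodule.mem_sup_left (Submodule.mem_span_singleton_self _))

lemma differentialAt_mem_osculatingSpace (x : M) (X : TangentSpace (𝓡 m) x) :
    differentialAt m (ambientMap f) x X ∈ osculatingSpace m f x :=
  Submodule.mem_sup_left (Submodule.mem_sup_right ⟨X, rfl⟩)

lemma firstNormalSpace_le_osculatingSpace (x : M) :
    firstNormalSpace m (prodForm k n) f x ≤ osculatingSpace m f x := le_sup_right

lemma mem_osculatingSpace_iff {x : M} {v : ∀ i, Fin (n i + 1) → ℝ} :
    v ∈ osculatingSpace m f x ↔ ∃ (c : ℝ) (X : TangentSpace (𝓡 m) x),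
      ∃ ξ ∈ firstNormalSpace m (prodForm k n) f x,
        v = c • ambientMap f x + differentialAt m (ambientMap f) x X + ξ := by
  constructor
  · intro h
    obtain ⟨u, hu, ξ, hξ, rfl⟩ := Submodule.mem_sup.1 h
    obtain ⟨a, ha, b, ⟨X, rfl⟩, rfl⟩ := Submodule.mem_sup.1 hu
    obtain ⟨c, rfl⟩ := Submodule.mem_span_singleton.1 ha
    exact ⟨c, X, ξ, hξ, rfl⟩
  · rintro ⟨c, X, ξ, hξ, rfl⟩
    exact Submodule.add_mem _ (Submodule.add_mem _
      (Submodule.smul_mem _ _ (ambientMap_mem_osculatingSpace x))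
      (differentialAt_mem_osculatingSpace x X)) (firstNormalSpace_le_osculatingSpace x hξ)

omit [IsManifold (𝓡 m) ∞ M] in
lemma firstNormalSpace_le_normalSpaceAt (B : LinearMap.BilinForm ℝ (∀ i, Fin (n i + 1) → ℝ))
    (x : M) : firstNormalSpace m B f x ≤ normalSpaceAt m B f x := by
  refine Submodule.span_le.2 ?_
  rintro _ ⟨X, Y, rfl⟩
  exact orthProj_mem _ _ _

lemma ContMDiff.hasFDerivAt_comp_extChartAt_symm {V : Type*} [NormedAddCommGroup V]
    [NormedSpace ℝ V] {F : M → V} (hF : ContMDiff (𝓡 m) 𝓘(ℝ, V) ∞ F) (x₀ : M)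
    {z : EuclideanSpace ℝ (Fin m)} (hz : z ∈ (extChartAt (𝓡 m) x₀).target) :
    HasFDerivAt (F ∘ (extChartAt (𝓡 m) x₀).symm)
      (fderiv ℝ (F ∘ (extChartAt (𝓡 m) x₀).symm) z) z :=
  ((hF.contDiffAt_comp_extChartAt_symm x₀ hz).differentiableAt (by simp)).hasFDerivAt

end ProductImmersion

/-! ### Gauss formula and derivatives of first normal sections for factorwise homothetic immersions
-/

section Homothetic

variable {ℓ : ℕ} {k : Fin ℓ → ℝ} {n : Fin ℓ → ℕ}
  {m : ℕ} {M : Type*} [TopologicalSpace M] [ChartedSpace (EuclideanSpace ℝ (Fin m)) M]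
  [IsManifold (𝓡 m) ∞ M] {f : M → prodSpaceForm k n}

lemma factorForm_fderiv_chart (hF : ContMDiff (𝓡 m) 𝓘(ℝ, ∀ i, Fin (n i + 1) → ℝ) ∞ (ambientMap f))
    (x₀ : M) {z : EuclideanSpace ℝ (Fin m)} (hz : z ∈ (extChartAt (𝓡 m) x₀).target) (i : Fin ℓ)
    (h : EuclideanSpace ℝ (Fin m)) :
    factorForm k n i (ambientMap f ((extChartAt (𝓡 m) x₀).symm z))
      (fderiv ℝ (ambientMap f ∘ (extChartAt (𝓡 m) x₀).symm) z h) = 0 := by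
  have hd := hF.hasFDerivAt_comp_extChartAt_symm x₀ hz
  have := HasFDerivAt.bilinForm_eq_zero (factorForm k n i) hd hd (c := 1 / k i)
    (Filter.Eventually.of_forall fun y => factorForm_self k n (f _).2 i) h
  rw [factorForm_comm] at this
  simp only [Function.comp_apply] at this
  linarith

lemma factorForm_differentialAt
    (hF : ContMDiff (𝓡 m) 𝓘(ℝ, ∀ i, Fin (n i + 1) → ℝ) ∞ (ambientMap f))
    (x : M) (X : TangentSpace (𝓡 m) x) (i : Fin ℓ) :
    factorForm k n i (ambientMap f x) (differentialAt m (ambientMap f) x X) = 0 := by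
  obtain ⟨h, hh⟩ := exists_differentialAt_eq (V := ∀ i, Fin (n i + 1) → ℝ) x
    (mem_extChartAt_source (I := 𝓡 m) x) X
  rw [hh (hF.mdifferentiable (by simp) _)]
  have := factorForm_fderiv_chart hF x (mem_extChartAt_target (I := 𝓡 m) x) i h
  rwa [(extChartAt (𝓡 m) x).left_inv (mem_extChartAt_source x)] at this

omit [IsManifold (𝓡 m) ∞ M] in
lemma factorForm_of_mem_normalSpaceAt (hk : ∀ i, k i ≠ 0) {x : M}
    {v : ∀ i, Fin (n i + 1) → ℝ} (hv : v ∈ normalSpaceAt m (prodForm k n) f x) (i : Fin ℓ) :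
    factorForm k n i (ambientMap f x) v = 0 :=
  (mem_tangentSpaceAt_prodSpaceForm hk (f x).2 v).1 hv.1 i

omit [IsManifold (𝓡 m) ∞ M] in
lemma prodForm_of_mem_normalSpaceAt {x : M}
    {v : ∀ i, Fin (n i + 1) → ℝ} (hv : v ∈ normalSpaceAt m (prodForm k n) f x)
    (X : TangentSpace (𝓡 m) x) :
    prodForm k n (differentialAt m (ambientMap f) x X) v = 0 :=
  LinearMap.BilinForm.mem_orthogonal_iff.1 hv.2 _ ⟨X, rfl⟩

/-- The differential of each factor of `f` is a homothety of ratio `√(s i)`. -/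
def IsFactorwiseHomothetic (m : ℕ) {M : Type*} [TopologicalSpace M]
    [ChartedSpace (EuclideanSpace ℝ (Fin m)) M] [IsManifold (𝓡 m) ∞ M]
    (f : M → prodSpaceForm k n) (s : Fin ℓ → ℝ) : Prop :=
  ∀ (i : Fin ℓ) (x : M) (X Y : TangentSpace (𝓡 m) x),
    factorForm k n i (differentialAt m (ambientMap f) x X) (differentialAt m (ambientMap f) x Y) =
      s i * prodForm k n (differentialAt m (ambientMap f) x X)
        (differentialAt m (ambientMap f) x Y)

variable {s : Fin ℓ → ℝ} {κ : ℝ}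

lemma IsFactorwiseHomothetic.chart (hs : IsFactorwiseHomothetic m f s)
    (hF : ContMDiff (𝓡 m) 𝓘(ℝ, ∀ i, Fin (n i + 1) → ℝ) ∞ (ambientMap f))
    (x₀ : M) {z : EuclideanSpace ℝ (Fin m)} (hz : z ∈ (extChartAt (𝓡 m) x₀).target) (i : Fin ℓ)
    (a b : EuclideanSpace ℝ (Fin m)) :
    factorForm k n i (fderiv ℝ (ambientMap f ∘ (extChartAt (𝓡 m) x₀).symm) z a)
      (fderiv ℝ (ambientMap f ∘ (extChartAt (𝓡 m) x₀).symm) z b) =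
    s i * prodForm k n (fderiv ℝ (ambientMap f ∘ (extChartAt (𝓡 m) x₀).symm) z a)
      (fderiv ℝ (ambientMap f ∘ (extChartAt (𝓡 m) x₀).symm) z b) := by
  obtain ⟨X, hX⟩ := exists_fderiv_chart_eq (V := ∀ i, Fin (n i + 1) → ℝ) x₀ hz a
  obtain ⟨Y, hY⟩ := exists_fderiv_chart_eq (V := ∀ i, Fin (n i + 1) → ℝ) x₀ hz b
  rw [hX (hF.mdifferentiable (by simp) _), hY (hF.mdifferentiable (by simp) _)]
  exact hs i _ X Y

/-- The Gauss formula: the second derivative of `f` is the second fundamental form up to a tangent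
vector and a multiple of the position vector. -/
lemma exists_secondDerivAt_eq (hk : ∀ i, k i ≠ 0)
    (hF : ContMDiff (𝓡 m) 𝓘(ℝ, ∀ i, Fin (n i + 1) → ℝ) ∞ (ambientMap f))
    (hs : IsFactorwiseHomothetic m f s) (hκ : ∀ i, k i * s i = κ) (x : M)
    (X Y : TangentSpace (𝓡 m) x) :
    ∃ (Z : TangentSpace (𝓡 m) x) (c : ℝ), secondDerivAt m (ambientMap f) x X Y =
      secondFundamentalForm m (prodForm k n) f x X Y +
        differentialAt m (ambientMap f) x Z + c • ambientMap f x := by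
  obtain ⟨Z, hZ⟩ := exists_eq_orthProj_add hk (f x).2 (differentialAt m (ambientMap f) x)
    (fun X i => factorForm_differentialAt hF x X i) (secondDerivAt m (ambientMap f) x X Y)
  set G := ambientMap f ∘ (extChartAt (𝓡 m) x).symm with hG
  set z := extChartAt (𝓡 m) x x with hz
  have hzt : z ∈ (extChartAt (𝓡 m) x).target := mem_extChartAt_target x
  have hinv : (extChartAt (𝓡 m) x).symm z = x :=
    (extChartAt (𝓡 m) x).left_inv (mem_extChartAt_source x)
  have hsm := hF.contDiffAt_comp_extChartAt_symm x hzt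
  set a : EuclideanSpace ℝ (Fin m) := X
  set b : EuclideanSpace ℝ (Fin m) := Y
  -- Derivative of `⟨f, f_* b⟩_i = 0` in the direction `a`.
  have hrad : ∀ i, factorForm k n i (ambientMap f x) (secondDerivAt m (ambientMap f) x X Y) =
      -(s i * prodForm k n (fderiv ℝ G z a) (fderiv ℝ G z b)) := by
    intro i
    have h1 := HasFDerivAt.bilinForm_eq_zero (factorForm k n i) (c := 0)
      (hF.hasFDerivAt_comp_extChartAt_symm x hzt) (hsm.hasFDerivAt_fderiv_apply b) (by
        filter_upwards [(isOpen_extChartAt_target (I := 𝓡 m) x).mem_nhds hzt] with y hy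
        exact factorForm_fderiv_chart hF x hy i b) a
    rw [hs.chart hF x hzt i a b, Function.comp_apply, hinv] at h1
    exact (neg_eq_of_add_eq_zero_right h1).symm
  refine ⟨Z, -(κ * prodForm k n (fderiv ℝ G z a) (fderiv ℝ G z b)), ?_⟩
  rw [hZ]
  congr 1
  -- Because `k_i s_i = κ` for all `i`, the radial terms of the factors have one common coefficient
  -- and recombine into a multiple of `f x`.
  conv_rhs => rw [← sum_factorProj n (ambientMap f x), Finset.smul_sum]
  refine Finset.sum_congr rfl fun i _ => ?_
  refine (congrArg (fun t : ℝ => (k i * t) • factorProj n i (ambientMap f x)) (hrad i)).trans ?_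
  rw [← hκ i, mul_neg, mul_assoc]

lemma prodForm_self (k : Fin ℓ → ℝ) (n : Fin ℓ → ℕ) {p : ∀ i, Fin (n i + 1) → ℝ}
    (hp : p ∈ prodSpaceForm k n) : prodForm k n p p = ∑ i, 1 / k i := by
  rw [prodForm_eq_sum]
  exact Finset.sum_congr rfl fun i _ => factorForm_self k n hp i

lemma prodForm_differentialAt
    (hF : ContMDiff (𝓡 m) 𝓘(ℝ, ∀ i, Fin (n i + 1) → ℝ) ∞ (ambientMap f))
    (x : M) (X : TangentSpace (𝓡 m) x) :
    prodForm k n (ambientMap f x) (differentialAt m (ambientMap f) x X) = 0 := by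
  rw [prodForm_eq_sum]
  exact Finset.sum_eq_zero fun i _ => factorForm_differentialAt hF x X i

/-- The components of a first normal vector are normal to the factors of `f`. -/
lemma factorForm_of_mem_firstNormalSpace (hk : ∀ i, k i ≠ 0)
    (hF : ContMDiff (𝓡 m) 𝓘(ℝ, ∀ i, Fin (n i + 1) → ℝ) ∞ (ambientMap f))
    (hs : IsFactorwiseHomothetic m f s) (hκ : ∀ i, k i * s i = κ) {x : M}
    {ξ : ∀ i, Fin (n i + 1) → ℝ} (hξ : ξ ∈ firstNormalSpace m (prodForm k n) f x) (i : Fin ℓ)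
    (Z : TangentSpace (𝓡 m) x) :
    factorForm k n i ξ (differentialAt m (ambientMap f) x Z) = 0 := by
  -- Homothety says that `C` vanishes on tangent vectors. By `bilinForm_second_deriv_eq_zero` the
  -- second derivatives of `f` are then `C`-orthogonal to them, and the Gauss formula passes this on
  -- to the second fundamental form.
  set C : LinearMap.BilinForm ℝ (∀ i, Fin (n i + 1) → ℝ) :=
    factorForm k n i - s i • prodForm k n with hC
  have hCa : ∀ u v, C u v = factorForm k n i u v - s i * prodForm k n u v := fun u v => rfl
  have hCs : ∀ u v, C u v = C v u := fun u v => by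
    rw [hCa, hCa, factorForm_comm, prodForm_comm]
  have hzt : extChartAt (𝓡 m) x x ∈ (extChartAt (𝓡 m) x).target := mem_extChartAt_target x
  have hα : ∀ X Y, C (secondFundamentalForm m (prodForm k n) f x X Y)
      (differentialAt m (ambientMap f) x Z) = 0 := by
    intro X Y
    obtain ⟨T, c, hT⟩ := exists_secondDerivAt_eq hk hF hs hκ x X Y
    rw [add_assoc, ← sub_eq_iff_eq_add] at hT
    rw [← hT]
    have h1 : C (differentialAt m (ambientMap f) x T) (differentialAt m (ambientMap f) x Z) = 0 :=
      sub_eq_zero.2 (hs i x T Z)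
    have h2 : C (ambientMap f x) (differentialAt m (ambientMap f) x Z) = 0 := by
      rw [hCa, factorForm_differentialAt hF, prodForm_differentialAt hF, mul_zero, sub_zero]
    have h3 : C (secondDerivAt m (ambientMap f) x X Y)
        (differentialAt m (ambientMap f) x Z) = 0 := by
      obtain ⟨h, hh⟩ := exists_differentialAt_eq (V := ∀ i, Fin (n i + 1) → ℝ) x
        (mem_extChartAt_source (I := 𝓡 m) x) Z
      rw [hh (hF.mdifferentiable (by simp) _)]
      refine bilinForm_second_deriv_eq_zero C hCs (hF.contDiffAt_comp_extChartAt_symm x hzt)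
        (fun a b => ?_) _ _ _
      filter_upwards [(isOpen_extChartAt_target (I := 𝓡 m) x).mem_nhds hzt] with y hy
      exact sub_eq_zero.2 (hs.chart hF x hy i a b)
    simp only [map_sub, map_add, map_smul, LinearMap.sub_apply, LinearMap.add_apply,
      LinearMap.smul_apply, h1, h2, h3]
    simp
  have hCξ : C ξ (differentialAt m (ambientMap f) x Z) = 0 := by
    refine Submodule.span_induction ?_ (by simp) (fun x y _ _ hx hy => ?_)
      (fun a x _ hx => ?_) hξ
    · rintro _ ⟨X, Y, rfl⟩
      exact hα X Y
    · rw [map_add, LinearMap.add_apply, hx, hy, add_zero]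
    · rw [map_smul, LinearMap.smul_apply, hx, smul_zero]
  rw [hCa, prodForm_comm, prodForm_of_mem_normalSpaceAt
    (firstNormalSpace_le_normalSpaceAt _ _ hξ), mul_zero, sub_zero] at hCξ
  exact hCξ

/-- Derivatives of sections of the first normal space stay in the osculating space. -/
lemma differentialAt_section_mem_osculatingSpace (hk : ∀ i, k i ≠ 0)
    (hF : ContMDiff (𝓡 m) 𝓘(ℝ, ∀ i, Fin (n i + 1) → ℝ) ∞ (ambientMap f))
    (hs : IsFactorwiseHomothetic m f s) (hκ : ∀ i, k i * s i = κ) {r : ℕ}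
    (hN : IsParallelNormalSubbundle m (prodForm k n) f (firstNormalSpace m (prodForm k n) f) r)
    {U : Set M} (hU : IsOpen U) {ξ : M → ∀ i, Fin (n i + 1) → ℝ}
    (hξ : ContMDiffOn (𝓡 m) 𝓘(ℝ, ∀ i, Fin (n i + 1) → ℝ) ∞ ξ U)
    (hmem : ∀ y ∈ U, ξ y ∈ firstNormalSpace m (prodForm k n) f y) {x : M} (hx : x ∈ U)
    (X : TangentSpace (𝓡 m) x) :
    differentialAt m ξ x X ∈ osculatingSpace m f x := by
  obtain ⟨Z, hZ⟩ := exists_eq_orthProj_add hk (f x).2 (differentialAt m (ambientMap f) x)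
    (fun X i => factorForm_differentialAt hF x X i) (differentialAt m ξ x X)
  -- Differentiating `⟨f, ξ⟩_i = 0` gives `⟨f_* X, ξ⟩_i + ⟨f, dξ X⟩_i = 0`, where the first term
  -- vanishes by `factorForm_of_mem_firstNormalSpace`.
  have hrad : ∀ i, factorForm k n i (ambientMap f x) (differentialAt m ξ x X) = 0 := by
    intro i
    set z := extChartAt (𝓡 m) x x with hz
    have hzt : z ∈ (extChartAt (𝓡 m) x).target := mem_extChartAt_target x
    have hinv : (extChartAt (𝓡 m) x).symm z = x :=
      (extChartAt (𝓡 m) x).left_inv (mem_extChartAt_source x)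
    obtain ⟨h, hh⟩ := exists_differentialAt_eq (V := ∀ i, Fin (n i + 1) → ℝ) x
      (mem_extChartAt_source (I := 𝓡 m) x) X
    have hξx : MDifferentiableAt (𝓡 m) 𝓘(ℝ, ∀ i, Fin (n i + 1) → ℝ) ξ x :=
      (hξ.contMDiffAt (hU.mem_nhds hx)).mdifferentiableAt (by simp)
    have hUz : ∀ᶠ y in 𝓝 z, (extChartAt (𝓡 m) x).symm y ∈ U := by
      refine (continuousAt_extChartAt_symm (I := 𝓡 m) x).eventually ?_
      rw [hinv]
      exact hU.mem_nhds hx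
    have hd := hF.hasFDerivAt_comp_extChartAt_symm x hzt
    have hξd : HasFDerivAt (ξ ∘ (extChartAt (𝓡 m) x).symm)
        (fderiv ℝ (ξ ∘ (extChartAt (𝓡 m) x).symm) z) z := by
      refine DifferentiableAt.hasFDerivAt ?_
      rw [← mdifferentiableAt_iff_differentiableAt]
      exact MDifferentiableAt.comp _ (hinv.symm ▸ hξx) (mdifferentiableAt_extChartAt_symm' x hzt)
    have h1 := HasFDerivAt.bilinForm_eq_zero (factorForm k n i) (c := 0) hd hξd (by
      filter_upwards [hUz] with y hy
      exact factorForm_of_mem_normalSpaceAt hk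
        (firstNormalSpace_le_normalSpaceAt _ _ (hmem _ hy)) i) h
    rw [← hh hξx, ← hh (hF.mdifferentiable (by simp) _), Function.comp_apply, Function.comp_apply,
      hinv, factorForm_comm, factorForm_of_mem_firstNormalSpace hk hF hs hκ (hmem x hx),
      zero_add] at h1
    exact h1
  rw [hZ, Finset.sum_eq_zero (fun i _ => by rw [hrad, mul_zero, zero_smul]), add_zero]
  exact Submodule.add_mem _ (firstNormalSpace_le_osculatingSpace x
    (hN.parallel U ξ hU hξ hmem x hx X)) (differentialAt_mem_osculatingSpace x Z)

/-- Second derivatives of `f` in a chart lie in the osculating space. -/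
lemma second_deriv_chart_mem_osculatingSpace (hk : ∀ i, k i ≠ 0)
    (hF : ContMDiff (𝓡 m) 𝓘(ℝ, ∀ i, Fin (n i + 1) → ℝ) ∞ (ambientMap f))
    (hs : IsFactorwiseHomothetic m f s) (hκ : ∀ i, k i * s i = κ) (x₀ : M)
    {z : EuclideanSpace ℝ (Fin m)} (hz : z ∈ (extChartAt (𝓡 m) x₀).target)
    (a b : EuclideanSpace ℝ (Fin m)) :
    fderiv ℝ (fderiv ℝ (ambientMap f ∘ (extChartAt (𝓡 m) x₀).symm)) z a b ∈
      osculatingSpace m f ((extChartAt (𝓡 m) x₀).symm z) := by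
  obtain ⟨X, Y, Z, h⟩ := exists_second_deriv_chart_eq hF x₀ hz a b
  obtain ⟨T, c, hT⟩ := exists_secondDerivAt_eq hk hF hs hκ _ X Y
  rw [h, hT]
  exact add_mem (add_mem (add_mem (firstNormalSpace_le_osculatingSpace _
    (Submodule.subset_span ⟨X, Y, rfl⟩)) (differentialAt_mem_osculatingSpace _ T))
    (Submodule.smul_mem _ _ (ambientMap_mem_osculatingSpace _)))
    (differentialAt_mem_osculatingSpace _ Z)

end Homothetic

/-! ### Constancy of the osculating space and proportionality of the scalar products on it -/

section OsculatingSpace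

variable {ℓ : ℕ} {k : Fin ℓ → ℝ} {n : Fin ℓ → ℕ}
  {m : ℕ} {M : Type*} [TopologicalSpace M] [ChartedSpace (EuclideanSpace ℝ (Fin m)) M]
  [IsManifold (𝓡 m) ∞ M] {f : M → prodSpaceForm k n} {s : Fin ℓ → ℝ} {κ : ℝ}

/-- The linear map parametrizing the span of a point, the range of a linear map and the span of
finitely many vectors. -/
noncomputable def frameMap {E V : Type*} [AddCommGroup E] [Module ℝ E] [AddCommGroup V] [Module ℝ V] {r : ℕ}
    (p : V) (L : E →ₗ[ℝ] V) (s : Fin r → V) : ℝ × E × (Fin r → ℝ) →ₗ[ℝ] V :=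
  (LinearMap.toSpanSingleton ℝ V p).coprod (L.coprod (Fintype.linearCombination ℝ s))

lemma frameMap_apply {E V : Type*} [AddCommGroup E] [Module ℝ E] [AddCommGroup V] [Module ℝ V]
    {r : ℕ} (p : V) (L : E →ₗ[ℝ] V) (s : Fin r → V) (d : ℝ × E × (Fin r → ℝ)) :
    frameMap p L s d = d.1 • p + (L d.2.1 + ∑ b, d.2.2 b • s b) := by
  simp [frameMap, Fintype.linearCombination_apply]

lemma range_frameMap {E V : Type*} [AddCommGroup E] [Module ℝ E] [AddCommGroup V] [Module ℝ V]
    {r : ℕ} (p : V) (L : E →ₗ[ℝ] V) (s : Fin r → V) :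
    LinearMap.range (frameMap p L s) =
      Submodule.span ℝ {p} ⊔ LinearMap.range L ⊔ Submodule.span ℝ (Set.range s) := by
  rw [frameMap, LinearMap.range_coprod, LinearMap.range_coprod, LinearMap.range_toSpanSingleton,
    Fintype.range_linearCombination, sup_assoc]

/-- The osculating spaces form a locally constant family. -/
lemma eventually_osculatingSpace_eq (hk : ∀ i, k i ≠ 0) (hk0 : ∑ i, 1 / k i ≠ 0)
    (hF : ContMDiff (𝓡 m) 𝓘(ℝ, ∀ i, Fin (n i + 1) → ℝ) ∞ (ambientMap f))
    (hinj : ∀ x, Function.Injective (differentialAt m (ambientMap f) x))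
    (hs : IsFactorwiseHomothetic m f s) (hκ : ∀ i, k i * s i = κ) {r : ℕ}
    (hN : IsParallelNormalSubbundle m (prodForm k n) f (firstNormalSpace m (prodForm k n) f) r)
    (x₀ : M) : ∀ᶠ x in 𝓝 x₀, osculatingSpace m f x = osculatingSpace m f x₀ := by
  obtain ⟨U, hU, hxU, σ, hσ, hspan⟩ := hN.exists_frame x₀
  set φ := extChartAt (𝓡 m) x₀ with hφ
  set G := ambientMap f ∘ φ.symm with hG
  set O : Set (EuclideanSpace ℝ (Fin m)) := φ.target ∩ φ.symm ⁻¹' U with hO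
  have hOopen : IsOpen O :=
    (continuousOn_extChartAt_symm (I := 𝓡 m) x₀).isOpen_inter_preimage
      (isOpen_extChartAt_target x₀) hU
  have hz₀ : φ x₀ ∈ O := ⟨mem_extChartAt_target x₀, by
    simpa [hφ, (extChartAt (𝓡 m) x₀).left_inv (mem_extChartAt_source x₀)] using hxU⟩
  have hGs : ContDiffOn ℝ ∞ G O :=
    (hF.contMDiffOn (s := U)).contDiffOn_comp_extChartAt_symm x₀
  have hσs : ∀ b, ContDiffOn ℝ ∞ (σ b ∘ φ.symm) O := fun b =>
    (hσ b).contDiffOn_comp_extChartAt_symm x₀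
  have hG's : ContDiffOn ℝ ∞ (fderiv ℝ G) O := hGs.fderiv_of_isOpen hOopen (by simp)
  set e : EuclideanSpace ℝ (Fin m) → (ℝ × EuclideanSpace ℝ (Fin m) × (Fin r → ℝ)) →L[ℝ]
      (∀ i, Fin (n i + 1) → ℝ) := fun z => LinearMap.toContinuousLinearMap
    (frameMap (G z) (fderiv ℝ G z).toLinearMap fun b => (σ b ∘ φ.symm) z) with he
  have heapp : ∀ z d, e z d = d.1 • G z + (fderiv ℝ G z d.2.1 +
      ∑ b, d.2.2 b • (σ b ∘ φ.symm) z) := fun z d => frameMap_apply _ _ _ d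
  have hes : ContDiffOn ℝ ∞ e O := by
    rw [contDiffOn_clm_apply]
    intro d
    simp only [heapp]
    exact (hGs.const_smul _).add ((hG's.clm_apply contDiffOn_const).add
      (ContDiffOn.sum fun b _ => (hσs b).const_smul _))
  have hrange : ∀ z ∈ O, LinearMap.range (e z).toLinearMap = osculatingSpace m f (φ.symm z) := by
    intro z hz
    have h1 : LinearMap.range (e z).toLinearMap = LinearMap.range (frameMap (G z)
      (fderiv ℝ G z).toLinearMap fun b => (σ b ∘ φ.symm) z) := rfl
    rw [h1, range_frameMap, osculatingSpace, hspan _ hz.2, ← range_fderiv_chart hF x₀ hz.1]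
    rfl
  have hderiv : ∀ z ∈ O, ∀ h d, fderiv ℝ e z h d ∈ LinearMap.range (e z).toLinearMap := by
    intro z hz h d
    have hnhds := hOopen.mem_nhds hz
    have hd1 : HasFDerivAt (fun y => e y d) ((fderiv ℝ e z).flip d) z := by
      simpa using ((hes.contDiffAt hnhds).differentiableAt (by simp)).hasFDerivAt.clm_apply
        (hasFDerivAt_const d z)
    have hd2 : HasFDerivAt (fun y => e y d) (d.1 • fderiv ℝ G z +
        ((fderiv ℝ (fderiv ℝ G) z).flip d.2.1 +
          ∑ b, d.2.2 b • fderiv ℝ (σ b ∘ φ.symm) z)) z := by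
      simp only [heapp]
      refine HasFDerivAt.fun_add (HasFDerivAt.fun_const_smul
        ((hGs.contDiffAt hnhds).differentiableAt (by simp)).hasFDerivAt _) (HasFDerivAt.fun_add
        ((hGs.contDiffAt hnhds).hasFDerivAt_fderiv_apply d.2.1) (HasFDerivAt.fun_sum fun b _ =>
          HasFDerivAt.fun_const_smul
            (((hσs b).contDiffAt hnhds).differentiableAt (by simp)).hasFDerivAt _))
    have heq := congrArg (fun T : EuclideanSpace ℝ (Fin m) →L[ℝ] ∀ i, Fin (n i + 1) → ℝ => T h)
      (hd1.unique hd2)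
    simp only [ContinuousLinearMap.flip_apply, add_apply,
      smul_apply, sum_apply] at heq
    rw [heq, hrange z hz]
    refine add_mem (Submodule.smul_mem _ _ ?_) (add_mem
      (second_deriv_chart_mem_osculatingSpace hk hF hs hκ x₀ hz.1 h d.2.1)
      (Submodule.sum_mem _ fun b _ => Submodule.smul_mem _ _ ?_))
    · obtain ⟨X, hX⟩ := exists_fderiv_chart_eq (V := ∀ i, Fin (n i + 1) → ℝ) x₀ hz.1 h
      rw [hX (hF.mdifferentiable (by simp) _)]
      exact differentialAt_mem_osculatingSpace _ X
    · obtain ⟨X, hX⟩ := exists_fderiv_chart_eq (V := ∀ i, Fin (n i + 1) → ℝ) x₀ hz.1 h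
      rw [hX (((hσ b).contMDiffAt (hU.mem_nhds hz.2)).mdifferentiableAt (by simp))]
      refine differentialAt_section_mem_osculatingSpace hk hF hs hκ hN hU (hσ b)
        (fun y hy => ?_) hz.2 X
      rw [hspan y hy]
      exact Submodule.subset_span ⟨b, rfl⟩
  have hinj₀ : Function.Injective (e (φ x₀)) := by
    have hx : φ.symm (φ x₀) = x₀ :=
      (extChartAt (𝓡 m) x₀).left_inv (mem_extChartAt_source x₀)
    rw [injective_iff_map_eq_zero]
    rintro ⟨t, a, c⟩ h0
    -- The chart derivative and the differential have the same range, so rank–nullity transfers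
    -- injectivity.
    have hrankL : LinearMap.ker (fderiv ℝ G (φ x₀)).toLinearMap = ⊥ := by
      have h1 := (fderiv ℝ G (φ x₀)).toLinearMap.finrank_range_add_finrank_ker
      rw [range_fderiv_chart hF x₀ hz₀.1, hx,
        LinearMap.finrank_range_of_inj (hinj x₀)] at h1
      have h2 : Module.finrank ℝ (TangentSpace (𝓡 m) x₀) =
        Module.finrank ℝ (EuclideanSpace ℝ (Fin m)) := rfl
      rw [h2] at h1
      exact Submodule.finrank_eq_zero.1 (by omega)
    have hrng := range_fderiv_chart hF x₀ hz₀.1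
    rw [hx] at hrng
    obtain ⟨X, hX⟩ : fderiv ℝ G (φ x₀) a ∈ LinearMap.range (differentialAt m (ambientMap f) x₀) :=
      hrng ▸ ⟨a, rfl⟩
    have hGx : G (φ x₀) = ambientMap f x₀ := congrArg (ambientMap f) hx
    have hσx : ∀ b, (σ b ∘ φ.symm) (φ x₀) = σ b x₀ := fun b => congrArg (σ b) hx
    rw [heapp] at h0
    simp only [hGx, hσx, ← hX] at h0
    set ξ := ∑ b, c b • σ b x₀ with hξ
    have hξN : ξ ∈ normalSpaceAt m (prodForm k n) f x₀ := by
      refine firstNormalSpace_le_normalSpaceAt _ _ ?_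
      rw [hspan x₀ hxU]
      exact Submodule.sum_mem _ fun b _ => Submodule.smul_mem _ _
        (Submodule.subset_span ⟨b, rfl⟩)
    -- Pairing with the position vector isolates `t`, because that vector is not null: its square is
    -- `∑ 1 / k i`.
    have ht : t = 0 := by
      have := congrArg (prodForm k n (ambientMap f x₀)) h0
      rw [map_add, map_add, map_smul, prodForm_differentialAt hF, prodForm_eq_sum k n _ ξ,
        Finset.sum_eq_zero (fun i _ => factorForm_of_mem_normalSpaceAt hk hξN i), map_zero,
        prodForm_self k n (f x₀).2, add_zero, add_zero, smul_eq_mul] at this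
      exact (mul_eq_zero.1 this).resolve_right hk0
    rw [ht, zero_smul, zero_add] at h0
    have hLX : differentialAt m (ambientMap f) x₀ X = 0 := by
      by_contra hne
      refine (prodForm_pos k n hk (f x₀).2 (factorForm_differentialAt hF x₀ X) hne).ne' ?_
      have := congrArg (prodForm k n (differentialAt m (ambientMap f) x₀ X)) h0
      rwa [map_add, prodForm_of_mem_normalSpaceAt hξN, add_zero, map_zero] at this
    have ha : a = 0 := by
      have : a ∈ LinearMap.ker (fderiv ℝ G (φ x₀)).toLinearMap := hX.symm.trans hLX
      rwa [hrankL] at this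
    rw [hLX, zero_add, hξ] at h0
    have hli : LinearIndependent ℝ fun b => σ b x₀ := by
      rw [linearIndependent_iff_card_eq_finrank_span, Set.finrank, ← hspan x₀ hxU,
        hN.finrank_eq, Fintype.card_fin]
    have hc : c = 0 := funext (Fintype.linearIndependent_iff.1 hli c h0)
    rw [ht, ha, hc]
    rfl
  have hmain := eventually_range_eq_of_fderiv_mem_range hOopen
    (hes.differentiableOn (by simp)) hz₀ hinj₀ hderiv
  have hx : φ.symm (φ x₀) = x₀ :=
    (extChartAt (𝓡 m) x₀).left_inv (mem_extChartAt_source x₀)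
  have hmain' : ∀ᶠ z in 𝓝 (φ x₀), osculatingSpace m f (φ.symm z) = osculatingSpace m f x₀ := by
    filter_upwards [hmain, hOopen.mem_nhds hz₀] with z hz hzO
    rw [← hrange z hzO, hz, hrange _ hz₀, hx]
  filter_upwards [(continuousAt_extChartAt (I := 𝓡 m) x₀).eventually hmain',
    (isOpen_extChartAt_source (I := 𝓡 m) x₀).mem_nhds (mem_extChartAt_source x₀)] with x hxe hxs
  rwa [(extChartAt (𝓡 m) x₀).left_inv hxs] at hxe

/-- The osculating spaces are all equal, and on them the scalar product of each factor is a
multiple of the total one. -/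
lemma osculatingSpace_eq [PreconnectedSpace M] (hk : ∀ i, k i ≠ 0) (hk0 : ∑ i, 1 / k i ≠ 0)
    (hF : ContMDiff (𝓡 m) 𝓘(ℝ, ∀ i, Fin (n i + 1) → ℝ) ∞ (ambientMap f))
    (hinj : ∀ x, Function.Injective (differentialAt m (ambientMap f) x))
    (hs : IsFactorwiseHomothetic m f s) (hκ : ∀ i, k i * s i = κ) {r : ℕ}
    (hN : IsParallelNormalSubbundle m (prodForm k n) f (firstNormalSpace m (prodForm k n) f) r)
    (x y : M) : osculatingSpace m f x = osculatingSpace m f y :=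
  IsLocallyConstant.apply_eq_of_preconnectedSpace
    ((IsLocallyConstant.iff_eventually_eq _).2
      (eventually_osculatingSpace_eq hk hk0 hF hinj hs hκ hN)) x y

/-- A fixed `v` lies in the osculating space at every point `y`, so the relation can first be
checked against `f y` by decomposing `v` at `y`. Differentiating once and twice in `y` then gives it
against tangent vectors and, by the Gauss formula, against first normal vectors. -/
lemma factorForm_eq_on_osculatingSpace [PreconnectedSpace M] (hk : ∀ i, k i ≠ 0)
    (hk0 : κ * ∑ i, 1 / k i = 1)
    (hF : ContMDiff (𝓡 m) 𝓘(ℝ, ∀ i, Fin (n i + 1) → ℝ) ∞ (ambientMap f))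
    (hinj : ∀ x, Function.Injective (differentialAt m (ambientMap f) x))
    (hs : IsFactorwiseHomothetic m f s) (hκ : ∀ i, k i * s i = κ) {r : ℕ}
    (hN : IsParallelNormalSubbundle m (prodForm k n) f (firstNormalSpace m (prodForm k n) f) r)
    (i : Fin ℓ) {x : M} {v w : ∀ i, Fin (n i + 1) → ℝ} (hv : v ∈ osculatingSpace m f x)
    (hw : w ∈ osculatingSpace m f x) :
    factorForm k n i v w = s i * prodForm k n v w := by
  have hk0' : ∑ i, 1 / k i ≠ 0 := right_ne_zero_of_mul (hk0.symm ▸ one_ne_zero)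
  set C : LinearMap.BilinForm ℝ (∀ i, Fin (n i + 1) → ℝ) :=
    factorForm k n i - s i • prodForm k n with hC
  have hCa : ∀ u v, C u v = factorForm k n i u v - s i * prodForm k n u v := fun u v => rfl
  have hC0 : ∀ y, C v (ambientMap f y) = 0 := by
    intro y
    rw [osculatingSpace_eq hk hk0' hF hinj hs hκ hN x y] at hv
    obtain ⟨c, X, ξ, hξ, rfl⟩ := mem_osculatingSpace_iff.1 hv
    have hξ' := firstNormalSpace_le_normalSpaceAt _ _ hξ
    -- The normalisation `κ ∑ 1 / k i = 1` enters here: it says `1 / k i = s i * ∑ 1 / k j`.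
    have h1 : C (ambientMap f y) (ambientMap f y) = 0 := by
      rw [hCa, factorForm_self k n (f y).2, prodForm_self k n (f y).2]
      rw [sub_eq_zero, div_eq_iff (hk i)]
      calc (1 : ℝ) = κ * ∑ i, 1 / k i := hk0.symm
        _ = s i * (∑ i, 1 / k i) * k i := by rw [← hκ i]; ring
    have h2 : C (differentialAt m (ambientMap f) y X) (ambientMap f y) = 0 := by
      rw [hCa, factorForm_comm, prodForm_comm, factorForm_differentialAt hF,
        prodForm_differentialAt hF, mul_zero, sub_zero]
    have h3 : C ξ (ambientMap f y) = 0 := by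
      rw [hCa, factorForm_comm, prodForm_comm, prodForm_eq_sum,
        Finset.sum_eq_zero (fun i _ => factorForm_of_mem_normalSpaceAt hk hξ' i),
        factorForm_of_mem_normalSpaceAt hk hξ', mul_zero, sub_zero]
    simp only [map_add, map_smul, LinearMap.add_apply, LinearMap.smul_apply, h1, h2, h3]
    simp
  have hzt : extChartAt (𝓡 m) x x ∈ (extChartAt (𝓡 m) x).target := mem_extChartAt_target x
  have hchart : ∀ z ∈ (extChartAt (𝓡 m) x).target, ∀ a,
      C v (fderiv ℝ (ambientMap f ∘ (extChartAt (𝓡 m) x).symm) z a) = 0 := fun z hz a =>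
    C.eq_zero_of_hasFDerivAt v (hF.hasFDerivAt_comp_extChartAt_symm x hz)
      (Filter.Eventually.of_forall fun y => hC0 _) a
  have hC1 : ∀ Z, C v (differentialAt m (ambientMap f) x Z) = 0 := by
    intro Z
    obtain ⟨h, hh⟩ := exists_differentialAt_eq (V := ∀ i, Fin (n i + 1) → ℝ) x
      (mem_extChartAt_source (I := 𝓡 m) x) Z
    rw [hh (hF.mdifferentiable (by simp) _)]
    exact hchart _ hzt h
  have hC2 : ∀ X Y, C v (secondDerivAt m (ambientMap f) x X Y) = 0 := by
    intro X Y
    refine C.eq_zero_of_hasFDerivAt v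
      ((hF.contDiffAt_comp_extChartAt_symm x hzt).hasFDerivAt_fderiv_apply Y) ?_ X
    filter_upwards [(isOpen_extChartAt_target (I := 𝓡 m) x).mem_nhds hzt] with y hy
    exact hchart y hy _
  have hC3 : ∀ ξ ∈ firstNormalSpace m (prodForm k n) f x, C v ξ = 0 := by
    intro ξ hξ
    refine Submodule.span_induction ?_ (by simp)
      (fun a b _ _ ha hb => by rw [map_add, ha, hb, add_zero])
      (fun c a _ ha => by rw [map_smul, ha, smul_zero]) hξ
    rintro _ ⟨X, Y, rfl⟩
    obtain ⟨T, c, hT⟩ := exists_secondDerivAt_eq hk hF hs hκ x X Y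
    have := hC2 X Y
    rw [hT, map_add, map_add, map_smul, hC1, hC0, smul_zero, add_zero, add_zero] at this
    exact this
  obtain ⟨c, X, ξ, hξ, rfl⟩ := mem_osculatingSpace_iff.1 hw
  refine sub_eq_zero.1 (show C v _ = 0 from ?_)
  rw [map_add, map_add, map_smul, hC0, hC1, hC3 ξ hξ, smul_zero, add_zero, add_zero]

end OsculatingSpace

/-! ### Linear isometries and totally geodesic immersions -/

section LinearIsometry

variable {V : Type*} [NormedAddCommGroup V] [NormedSpace ℝ V]

lemma exists_orthonormal_of_pos [FiniteDimensional ℝ V] {B : LinearMap.BilinForm ℝ V}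
    (hB : ∀ x y, B x y = B y x) {W : Submodule ℝ V} (hW : ∀ v ∈ W, v ≠ 0 → 0 < B v v) {d : ℕ}
    (hd : Module.finrank ℝ W = d) :
    ∃ b : Fin d → V, Submodule.span ℝ (Set.range b) = W ∧
      ∀ i j, B (b i) (b j) = if i = j then 1 else 0 := by
  subst hd
  have hsymm : LinearMap.IsSymm (B.restrict W) := ⟨fun x y => hB x y⟩
  obtain ⟨v, hv⟩ := LinearMap.BilinForm.exists_orthogonal_basis hsymm
  have hpos : ∀ i, 0 < B (v i) (v i) := fun i =>
    hW _ (v i).2 fun h => v.ne_zero i (Subtype.ext h)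
  have hsq : ∀ i, 0 < Real.sqrt (B (v i) (v i)) := fun i => Real.sqrt_pos.2 (hpos i)
  refine ⟨fun i => (Real.sqrt (B (v i) (v i)))⁻¹ • (v i : V), ?_, fun i j => ?_⟩
  · have hspan : Submodule.span ℝ (Set.range fun i => (v i : V)) = W := by
      have := congrArg (Submodule.map W.subtype) v.span_eq
      rwa [Submodule.map_span, Submodule.map_top, Submodule.range_subtype, ← Set.range_comp] at this
    refine Eq.trans (le_antisymm ?_ ?_) hspan
    · refine Submodule.span_le.2 ?_
      rintro _ ⟨i, rfl⟩
      exact Submodule.smul_mem _ _ (Submodule.subset_span ⟨i, rfl⟩)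
    · refine Submodule.span_le.2 ?_
      rintro _ ⟨i, rfl⟩
      have : (v i : V) = Real.sqrt (B (v i) (v i)) •
          ((Real.sqrt (B (v i) (v i)))⁻¹ • (v i : V)) := by
        rw [smul_smul, mul_inv_cancel₀ (hsq i).ne', one_smul]
      simp only
      rw [SetLike.mem_coe, this]
      exact Submodule.smul_mem _ _ (Submodule.subset_span ⟨i, rfl⟩)
  · simp only [map_smul, LinearMap.smul_apply, smul_eq_mul]
    split_ifs with h
    · subst h
      rw [← mul_assoc, ← mul_inv, Real.mul_self_sqrt (hpos i).le, inv_mul_cancel₀ (hpos i).ne']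
    · have : B (v i) (v j) = 0 := hv h
      rw [this, mul_zero, mul_zero]

/-- An isometric parametrization of the sum of a line and an orthogonal positive definite
subspace. -/
lemma exists_isometry_ambientForm [FiniteDimensional ℝ V] {B : LinearMap.BilinForm ℝ V}
    (hB : ∀ x y, B x y = B y x) {W : Submodule ℝ V} (hW : ∀ v ∈ W, v ≠ 0 → 0 < B v v) {d : ℕ}
    (hd : Module.finrank ℝ W = d) {κ : ℝ} (hκ : κ ≠ 0) {p : V} (hp : B p p = 1 / κ)
    (hpW : ∀ w ∈ W, B p w = 0) :
    ∃ Φ : (Fin (d + 1) → ℝ) →ₗ[ℝ] V, (∀ u v, B (Φ u) (Φ v) = ambientForm κ d u v) ∧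
      LinearMap.range Φ = Submodule.span ℝ {p} ⊔ W ∧
      ∃ c : ℝ, 0 < c ∧ Φ (Pi.single 0 1) = c • p := by
  obtain ⟨b, hspan, hb⟩ := exists_orthonormal_of_pos hB hW hd
  have hbW : ∀ i, b i ∈ W := fun i => hspan ▸ Submodule.subset_span ⟨i, rfl⟩
  -- With this factor `c • p` has square `κ⁻¹ |κ| = ±1`, the sign being that of the first coordinate
  -- in `ambientForm κ d`.
  set c := Real.sqrt |κ| with hc
  have hc0 : 0 < c := Real.sqrt_pos.2 (abs_pos.2 hκ)
  have hcc : c * c = |κ| := Real.mul_self_sqrt (abs_nonneg _)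
  set Φ : (Fin (d + 1) → ℝ) →ₗ[ℝ] V :=
    Fintype.linearCombination ℝ (Fin.cons (c • p) b : Fin (d + 1) → V) with hΦ
  have hΦa : ∀ u, Φ u = u 0 • c • p + ∑ i : Fin d, u i.succ • b i := fun u => by
    rw [hΦ, Fintype.linearCombination_apply, Fin.sum_univ_succ]
    simp
  refine ⟨Φ, fun u v => ?_, ?_, c, hc0, ?_⟩
  · have h1 : ∀ w : Fin d → ℝ, B p (∑ i, w i • b i) = 0 := fun w =>
      hpW _ (Submodule.sum_mem _ fun i _ => Submodule.smul_mem _ _ (hbW i))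
    have h2 : B (∑ i, u i.succ • b i) (∑ i, v i.succ • b i) =
        ∑ i : Fin d, u i.succ * v i.succ := by
      simp [map_sum, LinearMap.sum_apply, hb, mul_comm]
    have h3 : c * (c * B p p) = if κ < 0 then -1 else 1 := by
      rw [← mul_assoc, hcc, hp]
      split_ifs with h
      · rw [abs_of_neg h]
        field_simp
      · rw [abs_of_nonneg (not_lt.1 h)]
        field_simp
    rw [hΦa, hΦa, ambientForm_apply, ← h3, ← h2]
    simp only [map_add, map_smul, LinearMap.add_apply, LinearMap.smul_apply, smul_eq_mul, h1,
      hB (∑ i, u (Fin.succ i) • b i) p]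
    ring
  · rw [hΦ, Fintype.range_linearCombination, Fin.range_cons, Submodule.span_insert, hspan,
      Submodule.span_singleton_smul_eq (IsUnit.mk0 c hc0.ne')]
  · rw [hΦa]
    simp

lemma ambientForm_nondegenerate {k : ℝ} {d : ℕ} {u : Fin (d + 1) → ℝ}
    (h : ∀ v, ambientForm k d u v = 0) : u = 0 := by
  funext i
  refine Fin.cases ?_ (fun j => ?_) i
  · have := h (Pi.single 0 1)
    rw [ambientForm_single_succ] at this
    split_ifs at this <;> simpa using this
  · have := h (Pi.single j.succ 1)
    simpa [ambientForm_apply, Pi.single_apply] using this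

/-- A linear map preserving the scalar products restricts to a totally geodesic immersion of a
space form, provided that the position vector is normal to the target. -/
lemma isTotallyGeodesicImmersion_of_linear {κ : ℝ} (hκ : κ ≠ 0) {d : ℕ}
    {B : LinearMap.BilinForm ℝ V} (hB : ∀ x y, B x y = B y x) {S' : Set V}
    (h : spaceForm κ d → S') (H : (Fin (d + 1) → ℝ) →L[ℝ] V) (hH : ∀ p : spaceForm κ d, H p = h p)
    (hiso : ∀ u v, B (H u) (H v) = ambientForm κ d u v)
    (hperp : ∀ p ∈ spaceForm κ d, ∀ w ∈ tangentSpaceAt S' (H p), B w (H p) = 0) :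
    IsTotallyGeodesicImmersion (ambientForm κ d) B h := by
  refine ⟨H, H.contDiff, hH, fun p X _ Y _ => by rw [H.fderiv, hiso], fun γ hγ hS => ?_⟩
  refine orthProj_eq_zero ?_
  have hp : γ 0 ∈ spaceForm κ d := hS.self_of_nhds
  have hdd : DifferentiableAt ℝ (deriv γ) 0 := by
    simpa using (hγ.hasFDerivAt_fderiv_apply (1 : ℝ)).differentiableAt
  have hderiv : deriv (deriv fun t => H (γ t)) 0 = H (deriv (deriv γ) 0) := by
    have h1 : deriv (fun t => H (γ t)) =ᶠ[𝓝 0] fun t => H (deriv γ t) := by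
      filter_upwards [(hγ.of_le (m := 1) (by simp)).eventually (by simp)] with t ht
      exact (H.hasFDerivAt.comp_hasDerivAt t (ht.differentiableAt (by simp)).hasDerivAt).deriv
    rw [h1.deriv_eq]
    exact (H.hasFDerivAt.comp_hasDerivAt 0 hdd.hasDerivAt).deriv
  rw [hderiv, H.fderiv]
  set q := deriv (deriv γ) 0
  -- The acceleration splits into a tangent vector of the space form and a multiple of the position.
  -- `H` sends the first into the image of the differential and the second to a vector orthogonal to
  -- the tangent space of `S'`, so nothing normal is left.
  set v := q - (κ * ambientForm κ d (γ 0) q) • γ 0 with hv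
  have hvT : v ∈ tangentSpaceAt (spaceForm κ d) (γ 0) := by
    rw [mem_tangentSpaceAt_spaceForm hκ hp, hv, map_sub, map_smul, hp.1, smul_eq_mul]
    field_simp
    ring
  have hq : q = v + (κ * ambientForm κ d (γ 0) q) • γ 0 := by rw [hv]; abel
  rw [LinearMap.BilinForm.mem_orthogonal_iff]
  intro w hw
  rw [hq, map_add, map_smul, map_add, map_smul, hperp _ hp w hw.1, smul_zero, add_zero, hB]
  exact LinearMap.BilinForm.mem_orthogonal_iff.1 hw.2 _ ⟨v, hvT, rfl⟩

end LinearIsometry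

/-! ### The tensors `R_i` and the weights -/

section Weights

variable {ℓ : ℕ} {k : Fin ℓ → ℝ} {n : Fin ℓ → ℕ}

lemma inner_tensorR {m : ℕ} {M : Type*} [TopologicalSpace M]
    [ChartedSpace (EuclideanSpace ℝ (Fin m)) M] [IsManifold (𝓡 m) ∞ M] (gM : SmoothMetric m M)
    (f : M → prodSpaceForm k n) (i : Fin ℓ) (x : M) (X Y : TangentSpace (𝓡 m) x) :
    gM.inner x (tensorR gM f i x X) Y =
      factorForm k n i (differentialAt m (ambientMap f) x X)
        (differentialAt m (ambientMap f) x Y) := by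
  have h : ∀ (L : TangentSpace (𝓡 m) x →ₗ[ℝ] (∀ i, Fin (n i + 1) → ℝ)) v Y,
      gM.inner x (adjointAt m gM (prodForm k n) x L v) Y = prodForm k n v (L Y) := by
    intro L v Y
    have h1 := LinearMap.BilinForm.toDual_def (SmoothMetric.form_nondegenerate gM x)
      (m := adjointAt m gM (prodForm k n) x L v) (n := Y)
    have h2 : ((SmoothMetric.form gM x).toDual (SmoothMetric.form_nondegenerate gM x))
        (adjointAt m gM (prodForm k n) x L v) = (prodForm k n).compl₂ L v :=
      LinearEquiv.apply_symm_apply _ _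
    rw [h2] at h1
    exact h1.symm
  refine (h _ _ _).trans ?_
  rw [LinearMap.comp_apply, LinearMap.comp_apply, prodForm_factorProj, factorForm_apply,
    factorProj_same]
  rfl

/-- Both `M_i` and `λ` contain the factor `∏ k j`, which cancels: `M_i = (∏ k j) / k i` and `λ = (∏
k j) ∑ 1 / k j`. -/
lemma weight_eq (hk : ∀ i, k i ≠ 0) (i : Fin ℓ) :
    weight k i = Real.sqrt (1 / (k i * ∑ j, 1 / k j)) := by
  have hco : ∀ i, coProd k i = (∏ j, k j) * (1 / k i) := fun i => by
    rw [coProd, ← Finset.mul_prod_erase Finset.univ k (Finset.mem_univ i)]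
    field_simp [hk i]
  have hP : ∏ j, k j ≠ 0 := Finset.prod_ne_zero_iff.2 fun j _ => hk j
  rw [weight, hco, Finset.sum_congr rfl (fun j _ => hco j), ← Finset.mul_sum,
    mul_div_mul_left _ _ hP, div_div]

end Weights

/-! ### Construction of the factorization -/

lemma differentialAt_clm_comp {m : ℕ} {M : Type*} [TopologicalSpace M]
    [ChartedSpace (EuclideanSpace ℝ (Fin m)) M] [IsManifold (𝓡 m) ∞ M]
    {V V' : Type*} [NormedAddCommGroup V] [NormedSpace ℝ V] [NormedAddCommGroup V']
    [NormedSpace ℝ V'] (T : V →L[ℝ] V') {F : M → V} {x : M}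
    (hF : MDifferentiableAt (𝓡 m) 𝓘(ℝ, V) F x) (X : TangentSpace (𝓡 m) x) :
    differentialAt m (fun y => T (F y)) x X = T (differentialAt m F x X) := by
  have h := mfderiv_comp x (T.mdifferentiableAt (x := F x)) hF
  rw [ContinuousLinearMap.mfderiv_eq] at h
  exact congrArg (fun S : TangentSpace (𝓡 m) x →L[ℝ] V' => S X) h

theorem theorem3p23 {ℓ m nbar : ℕ} (hm : 0 < m) (k : Fin ℓ → ℝ) (n : Fin ℓ → ℕ)
    (hk : ∀ i, k i ≠ 0)
    {M : Type*} [TopologicalSpace M] [ConnectedSpace M]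
    [ChartedSpace (EuclideanSpace ℝ (Fin m)) M] [IsManifold (𝓡 m) ∞ M]
    (gM : SmoothMetric m M) (f : M → prodSpaceForm k n)
    (hf : IsIsometricImmersion m gM (prodForm k n) f)
    (hN : IsParallelNormalSubbundle m (prodForm k n) f (firstNormalSpace m (prodForm k n) f) nbar)
    (hR : ∀ (i j : Fin ℓ) (x : M), k i • tensorR gM f i x = k j • tensorR gM f j x) :
    (∀ i j, 0 < k i * k j) ∧ (∀ i, m + nbar ≤ n i) ∧
      ∃ (κ : ℝ) (j : ∀ i, spaceForm (k i) (m + nbar) → spaceForm (k i) (n i))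
        (g : spaceForm κ (m + nbar) → prodSpaceForm k (fun _ => m + nbar))
        (fbar : M → spaceForm κ (m + nbar)),
        (∀ i, κ = weight k i ^ 2 * k i) ∧
        (∀ i, IsTotallyGeodesicInclusion (j i)) ∧
        IsStandardWeightedSum g ∧
        IsTotallyGeodesicImmersion (ambientForm κ (m + nbar))
          (prodForm k (fun _ => m + nbar)) g ∧
        IsIsometricImmersion m gM (ambientForm κ (m + nbar)) fbar ∧
        f = prodSpaceFormMap j ∘ g ∘ fbar := by
  obtain ⟨x₀⟩ : Nonempty M := inferInstance
  have hF : ContMDiff (𝓡 m) 𝓘(ℝ, ∀ i, Fin (n i + 1) → ℝ) ∞ (ambientMap f) := hf.contMDiff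
  have hiso : ∀ x X Y, prodForm k n (differentialAt m (ambientMap f) x X)
      (differentialAt m (ambientMap f) x Y) = gM.inner x X Y := hf.isometric
  have hinj : ∀ x, Function.Injective (differentialAt m (ambientMap f) x) := by
    intro x
    rw [injective_iff_map_eq_zero]
    intro X hX
    by_contra hne
    refine (gM.pos x X hne).ne' ?_
    rw [← hiso, hX, map_zero]
  set σ := ∑ i, 1 / k i with hσ
  -- the factors of `f` are homothetic
  have hhom : ∀ i x X Y, k i * σ * factorForm k n i (differentialAt m (ambientMap f) x X)
      (differentialAt m (ambientMap f) x Y) = prodForm k n (differentialAt m (ambientMap f) x X)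
      (differentialAt m (ambientMap f) x Y) := by
    intro i x X Y
    have hRi : ∀ j, k j * factorForm k n j (differentialAt m (ambientMap f) x X)
        (differentialAt m (ambientMap f) x Y) = k i * factorForm k n i
        (differentialAt m (ambientMap f) x X) (differentialAt m (ambientMap f) x Y) := by
      intro j
      have := congrArg (fun T : TangentSpace (𝓡 m) x →ₗ[ℝ] TangentSpace (𝓡 m) x =>
        gM.inner x (T X) Y) (hR j i x)
      simpa [inner_tensorR] using this
    -- Each summand `⟨·,·⟩_j` is `1 / k j` times the value `k j ⟨·,·⟩_j` common to all `j`; summing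
    -- produces `σ`.
    rw [prodForm_eq_sum, mul_right_comm, hσ, Finset.mul_sum]
    refine Finset.sum_congr rfl fun j _ => ?_
    rw [← hRi j]
    field_simp [hk j]
  have : Nontrivial (TangentSpace (𝓡 m) x₀) := by
    have : Nonempty (Fin m) := ⟨⟨0, hm⟩⟩
    exact inferInstanceAs (Nontrivial (EuclideanSpace ℝ (Fin m)))
  obtain ⟨X₀, hX₀⟩ := exists_ne (0 : TangentSpace (𝓡 m) x₀)
  have hgX₀ := gM.pos x₀ X₀ hX₀
  rw [← hiso] at hgX₀
  have hkσ : ∀ i, 0 < k i * σ := by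
    intro i
    rw [← hhom i] at hgX₀
    -- `k i * σ` times the square of the `i`-th component of `f_* X₀` is positive, and that
    -- component is tangent to a space form, so its square is nonnegative.
    refine (pos_iff_pos_of_mul_pos hgX₀).2 (lt_of_le_of_ne ?_ (right_ne_zero_of_mul hgX₀.ne').symm)
    rw [factorForm_apply]
    by_cases h0 : differentialAt m (ambientMap f) x₀ X₀ i = 0
    · rw [h0, map_zero]
    · exact (ambientForm_pos (hk i) ((f x₀).2 i) (factorForm_differentialAt hF x₀ X₀ i) h0).le
  -- With no factors the product form would be zero, contradicting that `f_* X₀` has positive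
  -- square.
  obtain ⟨i₀⟩ : Nonempty (Fin ℓ) := by
    by_contra hempty
    rw [not_nonempty_iff] at hempty
    rw [prodForm_eq_sum, Finset.univ_eq_empty, Finset.sum_empty] at hgX₀
    exact lt_irrefl _ hgX₀
  have hσ0 : σ ≠ 0 := right_ne_zero_of_mul (hkσ i₀).ne'
  set κ := 1 / σ with hκσ
  have hκ0 : κ ≠ 0 := one_div_ne_zero hσ0
  set s : Fin ℓ → ℝ := fun i => 1 / (k i * σ) with hsdef
  have hspos : ∀ i, 0 < s i := fun i => one_div_pos.2 (hkσ i)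
  have hκ : ∀ i, k i * s i = κ := fun i => by
    rw [hsdef, hκσ]
    field_simp [hk i]
  have hs : IsFactorwiseHomothetic m f s := by
    intro i x X Y
    rw [← hhom i, ← mul_assoc, hsdef, one_div_mul_cancel (hkσ i).ne', one_mul]
  have hκ1 : κ * ∑ i, 1 / k i = 1 := by
    rw [hκσ, ← hσ, one_div_mul_cancel hσ0]
  have hsign : ∀ i, k i < 0 ↔ κ < 0 := by
    intro i
    rw [← hκ i]
    exact ⟨fun h => mul_neg_of_neg_of_pos h (hspos i), fun h => by
      by_contra hc
      exact absurd h (not_lt.2 (mul_nonneg (not_lt.1 hc) (hspos i).le))⟩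
  have hform : ∀ i, ambientForm (k i) (m + nbar) = ambientForm κ (m + nbar) := fun i =>
    ambientForm_congr (hsign i) _
  have hw : ∀ i, weight k i = Real.sqrt (s i) := fun i => weight_eq hk i
  have hwpos : ∀ i, 0 < weight k i := fun i => hw i ▸ Real.sqrt_pos.2 (hspos i)
  have hwsq : ∀ i, weight k i ^ 2 = s i := fun i => by rw [hw, Real.sq_sqrt (hspos i).le]
  -- the constant osculating space and its isometric parametrization
  set W₀ := LinearMap.range (differentialAt m (ambientMap f) x₀) ⊔
    firstNormalSpace m (prodForm k n) f x₀ with hW₀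
  have hnormal : firstNormalSpace m (prodForm k n) f x₀ ≤ normalSpaceAt m (prodForm k n) f x₀ :=
    firstNormalSpace_le_normalSpaceAt _ _
  have hW₀T : ∀ v ∈ W₀, ∀ i, factorForm k n i (ambientMap f x₀) v = 0 := by
    intro v hv i
    obtain ⟨_, ⟨X, rfl⟩, ξ, hξ, rfl⟩ := Submodule.mem_sup.1 hv
    rw [map_add, factorForm_differentialAt hF, factorForm_of_mem_normalSpaceAt hk (hnormal hξ),
      add_zero]
  have hW₀pos : ∀ v ∈ W₀, v ≠ 0 → 0 < prodForm k n v v := fun v hv =>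
    prodForm_pos k n hk (f x₀).2 (hW₀T v hv)
  have hdim : Module.finrank ℝ W₀ = m + nbar := by
    have hdisj : LinearMap.range (differentialAt m (ambientMap f) x₀) ⊓
        firstNormalSpace m (prodForm k n) f x₀ = ⊥ := by
      rw [Submodule.eq_bot_iff]
      rintro v ⟨⟨X, rfl⟩, hv⟩
      by_contra hne
      exact (hW₀pos _ (Submodule.mem_sup_right hv) hne).ne'
        (prodForm_of_mem_normalSpaceAt (hnormal hv) X)
    have h1 := Submodule.finrank_sup_add_finrank_inf_eq
      (LinearMap.range (differentialAt m (ambientMap f) x₀))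
      (firstNormalSpace m (prodForm k n) f x₀)
    rw [hdisj, finrank_bot, LinearMap.finrank_range_of_inj (hinj x₀), hN.finrank_eq] at h1
    have h2 : Module.finrank ℝ (TangentSpace (𝓡 m) x₀) = m :=
      finrank_euclideanSpace_fin (𝕜 := ℝ)
    rw [h2, add_zero] at h1
    exact h1
  have hself : ∀ x, prodForm k n (ambientMap f x) (ambientMap f x) = 1 / κ := fun x => by
    rw [prodForm_self k n (f x).2, hκσ, one_div_one_div]
  obtain ⟨Φ, hΦ, hΦr, c, hc, hΦ0⟩ := exists_isometry_ambientForm (prodForm_comm k n) hW₀pos hdim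
    hκ0 (hself x₀) (fun w hw => by
      rw [prodForm_eq_sum]
      exact Finset.sum_eq_zero fun i _ => hW₀T w hw i)
  have hΦosc : ∀ x, LinearMap.range Φ = osculatingSpace m f x := fun x => by
    rw [hΦr, hW₀, ← sup_assoc]
    exact osculatingSpace_eq hk hσ0 hF hinj hs hκ hN x₀ x
  have hΦi : ∀ i u v, factorForm k n i (Φ u) (Φ v) = s i * ambientForm κ (m + nbar) u v := by
    intro i u v
    rw [← hΦ]
    exact factorForm_eq_on_osculatingSpace hk hκ1 hF hinj hs hκ hN i (x := x₀)
      (hΦosc x₀ ▸ ⟨u, rfl⟩) (hΦosc x₀ ▸ ⟨v, rfl⟩)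
  have hΦinj : LinearMap.ker Φ = ⊥ := by
    rw [LinearMap.ker_eq_bot']
    intro u hu
    refine ambientForm_nondegenerate (k := κ) fun v => ?_
    rw [← hΦ, hu, map_zero, LinearMap.zero_apply]
  -- Any linear left inverse will do: `Ψ` is only evaluated on the range of `Φ`, the common
  -- osculating space.
  obtain ⟨Ψ, hΨ⟩ := LinearMap.exists_leftInverse_of_injective Φ hΦinj
  have hΦΨ : ∀ x, ∀ v ∈ osculatingSpace m f x, Φ (Ψ v) = v := by
    intro x v hv
    rw [← hΦosc x] at hv
    obtain ⟨u, rfl⟩ := hv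
    exact congrArg Φ (LinearMap.congr_fun hΨ u)
  have hΨform : ∀ x, ∀ v ∈ osculatingSpace m f x, ∀ w ∈ osculatingSpace m f x,
      ambientForm κ (m + nbar) (Ψ v) (Ψ w) = prodForm k n v w := by
    intro x v hv w hw
    rw [← hΦ, hΦΨ x v hv, hΦΨ x w hw]
  -- the maps `j i`
  set J : ∀ i, (Fin (m + nbar + 1) → ℝ) →ₗ[ℝ] (Fin (n i + 1) → ℝ) := fun i =>
    (weight k i)⁻¹ • (LinearMap.proj i ∘ₗ Φ) with hJ
  have hJa : ∀ i u, J i u = (weight k i)⁻¹ • Φ u i := fun i u => rfl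
  have hJform : ∀ i u v, ambientForm (k i) (n i) (J i u) (J i v) =
      ambientForm (k i) (m + nbar) u v := by
    intro i u v
    rw [hJa, hJa, map_smul, map_smul, LinearMap.smul_apply, ← factorForm_apply k n i (Φ u) (Φ v),
      hΦi, hform, ← hwsq]
    have := (hwpos i).ne'
    simp only [smul_eq_mul]
    field_simp
  have hκk : ∀ i, weight k i * (weight k i * (1 / κ)) = 1 / k i := by
    intro i
    rw [← mul_assoc, ← sq, hwsq, ← hκ i]
    have := (hspos i).ne'
    have := hk i
    field_simp
  have hJmem : ∀ i, ∀ p ∈ spaceForm (k i) (m + nbar), J i p ∈ spaceForm (k i) (n i) := by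
    intro i p hp
    refine ⟨by rw [hJform, hp.1], fun hneg => ?_⟩
    -- `J i` sends the first basis vector to a positive multiple of the `i`-th component of `f x₀`,
    -- which is on the upper sheet. The image of `p` has negative product with it, hence is on the
    -- same sheet.
    refine pos_of_ambientForm_neg hneg (p := J i (Pi.single 0 1)) ?_ ?_ ?_ ?_
    · rw [hJform, ambientForm_single_succ, if_pos hneg]
      simp
    · rw [hJform, hp.1]
      exact one_div_neg.2 hneg
    · rw [hJa, hΦ0]
      exact mul_pos (inv_pos.2 (hwpos i)) (mul_pos hc (((f x₀).2 i).2 hneg))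
    · rw [hJform, ambientForm_comm, ambientForm_single_succ, if_pos hneg]
      have := hp.2 hneg
      linarith
  -- the map `g`
  set H : (Fin (m + nbar + 1) → ℝ) →L[ℝ] (Fin ℓ → Fin (m + nbar + 1) → ℝ) :=
    ContinuousLinearMap.pi fun i => weight k i • ContinuousLinearMap.id ℝ _ with hH
  have hHa : ∀ u i, H u i = weight k i • u := fun u i => rfl
  have hHmem : ∀ p ∈ spaceForm κ (m + nbar), H p ∈ prodSpaceForm k fun _ => m + nbar := by
    intro p hp i
    refine ⟨?_, fun hneg => ?_⟩
    · rw [hHa, map_smul, map_smul, LinearMap.smul_apply, hform, hp.1, smul_eq_mul, smul_eq_mul,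
        hκk]
    · rw [hHa]
      exact mul_pos (hwpos i) (hp.2 ((hsign i).1 hneg))
  have hsum : ∑ i, s i = 1 := by
    rw [← hκ1, Finset.mul_sum]
    refine Finset.sum_congr rfl fun i _ => ?_
    rw [← hκ i]
    have := hk i
    field_simp
  -- the map `fbar`
  have hfbar : ∀ x, Ψ (ambientMap f x) ∈ spaceForm κ (m + nbar) := by
    intro x
    have hx := ambientMap_mem_osculatingSpace (m := m) (f := f) x
    refine ⟨by rw [hΨform x _ hx _ hx, hself], fun hneg => ?_⟩
    -- This product is `c ⟨f x, f x₀⟩`, a sum over the factors of products of points of the same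
    -- sheet, each of them negative.
    have h1 : ambientForm κ (m + nbar) (Ψ (ambientMap f x)) (Pi.single 0 1) < 0 := by
      rw [← hΦ, hΦΨ x _ hx, hΦ0, map_smul, smul_eq_mul, prodForm_apply]
      refine mul_neg_of_pos_of_neg hc (Finset.sum_neg (fun i _ => ?_) ⟨i₀, Finset.mem_univ _⟩)
      have hki := (hsign i).2 hneg
      refine ambientForm_neg hki ?_ ?_ (((f x).2 i).2 hki) (((f x₀).2 i).2 hki)
      · exact ((f x).2 i).1.trans_lt (one_div_neg.2 hki)
      · exact ((f x₀).2 i).1.trans_lt (one_div_neg.2 hki)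
    rw [ambientForm_single_succ, if_pos hneg] at h1
    linarith
  -- Every `T_i` can be taken to be the identity: the relative position of the factors is absorbed
  -- by the `J i`, which all come from the same `Φ`.
  refine ⟨fun i j => ?_, fun i => ?_, κ, fun i p => ⟨J i p, hJmem i p p.2⟩,
    fun p => ⟨H p, hHmem p p.2⟩, fun x => ⟨Ψ (ambientMap f x), hfbar x⟩, fun i => ?_, fun i => ?_,
    ⟨fun _ => LinearEquiv.refl ℝ _, fun _ _ _ => rfl, fun _ => Set.image_id _, fun _ _ => rfl⟩,
    ?_, ?_, ?_⟩
  · refine pos_of_mul_pos_left (b := σ * σ) ?_ (mul_self_nonneg _)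
    calc 0 < (k i * σ) * (k j * σ) := mul_pos (hkσ i) (hkσ j)
      _ = _ := by ring
  · have hJinj : Function.Injective (J i) := by
      rw [injective_iff_map_eq_zero]
      intro u hu
      refine ambientForm_nondegenerate (k := k i) fun v => ?_
      rw [← hJform, hu, map_zero, LinearMap.zero_apply]
    have := LinearMap.finrank_le_finrank_of_injective hJinj
    rw [Module.finrank_fin_fun, Module.finrank_fin_fun] at this
    omega
  · rw [hwsq, mul_comm, hκ]
  · refine ⟨?_, J i, hJform i, fun _ => rfl⟩
    refine isTotallyGeodesicImmersion_of_linear (hk i) (ambientForm_comm _ _) _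
      (LinearMap.toContinuousLinearMap (J i)) (fun _ => rfl) (hJform i) (fun p hp w hw => ?_)
    rw [ambientForm_comm]
    exact (mem_tangentSpaceAt_spaceForm (hk i) (hJmem i p hp) w).1 hw
  · refine isTotallyGeodesicImmersion_of_linear hκ0 (prodForm_comm _ _) _ H (fun _ => rfl)
      (fun u v => ?_) (fun p hp w hw => ?_)
    · rw [prodForm_apply]
      calc _ = ∑ i, s i * ambientForm κ (m + nbar) u v := Finset.sum_congr rfl fun i _ => by
            rw [hHa, hHa, map_smul, map_smul, LinearMap.smul_apply, hform, smul_eq_mul,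
              smul_eq_mul, ← mul_assoc, ← sq, hwsq]
        _ = _ := by rw [← Finset.sum_mul, hsum, one_mul]
    · rw [prodForm_comm, prodForm_eq_sum]
      exact Finset.sum_eq_zero fun i _ =>
        (mem_tangentSpaceAt_prodSpaceForm hk (hHmem p hp) w).1 hw i
  · refine ⟨(LinearMap.toContinuousLinearMap Ψ).contMDiff.comp hF, fun x X Y => ?_⟩
    have hd : ∀ X, differentialAt m (fun y => Ψ (ambientMap f y)) x X =
        Ψ (differentialAt m (ambientMap f) x X) := fun X =>
      differentialAt_clm_comp (LinearMap.toContinuousLinearMap Ψ)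
        (hF.mdifferentiable (by simp) x) X
    have hmem := differentialAt_mem_osculatingSpace (m := m) (f := f) x
    change ambientForm κ (m + nbar) (differentialAt m (fun y => Ψ (ambientMap f y)) x X)
      (differentialAt m (fun y => Ψ (ambientMap f y)) x Y) = _
    rw [hd, hd, hΨform x _ (hmem X) _ (hmem Y), hiso]
  · funext x
    refine Subtype.ext (funext fun i => ?_)
    change ambientMap f x i = J i (H (Ψ (ambientMap f x)) i)
    rw [hHa, map_smul, hJa, hΦΨ x _ (ambientMap_mem_osculatingSpace x), smul_smul,
      mul_inv_cancel₀ (hwpos i).ne', one_smul]
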